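/- **Setting.** Let $\mathcal X$ be a measurable space, $p\ge 1$, and let $\mathcal D$ be a probability distribution of $(X,Y,Z)$ on $\mathcal X\times\{0,1\}\times[p]$ (features, label, protected attribute). Let $\mathcal F\subseteq\{0,1\}^{\mathcal X\times[p]}$ be a class of measurable classifiers of VC dimension $d\in\mathbb N$ that do not use the protected attribute for prediction, i.e. $f(x,z)=f(x,z')$ for all $f\in\mathcal F$, $x,z,z'$; as usual for uniform convergence, $\mathcal F$ is assumed pointwise measurable (it has a countable subclass such that each member of $\mathcal F$ is a pointwise limit of a sequence from it). For a distribution $\mu$ put ${\rm Err}_\mu(f)=\Pr_\mu[f(X,Z)\ne Y]$. Let $\mathcal E(f),\mathcal E'(f)$ be two measurable events that depend on $f$ through its prediction: for fixed measurable sets $E_0,E_1,E_0',E_1'$ of data points, $\mathcal E(f)$ is the event $(X,Y,Z)\in E_{f(X,Z)}$ and $\mathcal E'(f)$ is the event $(X,Y,Z)\in E'_{f(X,Z)}$. Put $$q_\ell(f)=\Pr_\mu[\mathcal E(f)\mid\mathcal E'(f),Z=\ell],\qquad \Omega_\mu(f)=\frac{\min_{\ell}q_\ell(f)}{\max_{\ell}q_\ell(f)}$$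 (with $0/0=0$, and a conditional probability given a null event read as $0$). For $\tau\in(0,1]$ let $f^\star$ minimise ${\rm Err}_{\mathcal D}(f)$ over the $f\in\mathcal F$ with $\Omega_{\mathcal D}(f)\ge\tau$, and put $$\lambda_\ell=\Pr_{\mathcal D}[\mathcal E(f^\star),\mathcal E'(f^\star),Z=\ell],\quad \gamma_\ell=\Pr_{\mathcal D}[\mathcal E'(f^\star),Z=\ell],\quad \lambda=\min_{\ell\in[p]}\lambda_\ell .$$ For $\eta,\Delta\ge 0$ let $s=s(\Delta)$ be the optimal value of $$\min_{\eta_1,\dots,\eta_p\ge 0}\ \min_{\ell,k\in[p]}\ \frac{1-\eta_\ell/\lambda_\ell}{1+(\eta_k-\eta_\ell)/\gamma_\ell}\cdot\frac{1+(\eta_\ell-\eta_k)/\gamma_k}{1+\eta_\ell/\lambda_k}\quad\text{s.t.}\quad\sum_{\ell\in[p]}\eta_\ell\le\eta+\Delta .$$ Given perturbed samples $\widehat S$ with empirical distribution $\widehat D$ (of $(X,Y,\widehat Z)$), the program ErrTolerant+ with parameters $\eta,\Delta$ is $$\min_{f\in\mathcal F}{\rm Err}_{\widehat D}(f)\quad\text{s.t.}\quad\Omega_{\widehat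 D}(f)\ge\tau s(\Delta),\qquad \Pr_{\widehat D}[\mathcal E(f),\mathcal E'(f),\widehat Z=\ell]\ge\lambda_\ell-\eta-\Delta\ \ \text{for all }\ell\in[p].$$ An $\eta$-Hamming adversary is an arbitrary randomized map that, given $N$ i.i.d. samples from $\mathcal D$, changes the protected attributes of at most $\eta N$ of them; it may depend on $\mathcal D$ and on the learner. **Theorem.** There are an absolute constant $c>0$ and a fixed polynomial $P$ in three variables such that the following holds in every setting as above, for all $\eta\in(0,\lambda/2)$, $\varepsilon>2\eta$, $\delta\in(0,1)$ and all $\nu\in\mathbb R$. 1. Let $\Delta>0$ satisfy $$\nu>\tau\Big(1-s(\Delta)+\frac{4\eta}{\lambda-2\eta}\Big),\qquad \Delta\le c\cdot\min\Big\{\varepsilon-2\eta,\ \nu-\tau\Big(1-s(\Delta)+\frac{4\eta}{\lambda-2\eta}\Big),\ \lambda-2\eta\Big\},$$ and let $N\ge P\big(d,\tfrac1\Delta,\log\tfrac p\delta\big)$. Then for every $\eta$-Hamming adversary, with probability at least $1-\delta$ over the $N$ i.i.d. samples and the randomness of the adversary (that is, the failure event has outer measure at most $\delta$), ErrTolerant+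 on the perturbed samples has an optimal solution, and every optimal solution $f_{\rm ET}$ satisfies $${\rm Err}_{\mathcal D}(f_{\rm ET})-{\rm Err}_{\mathcal D}(f^\star)\le\varepsilon\qquad\text{and}\qquad\Omega_{\mathcal D}(f_{\rm ET})\ge\tau-\nu .$$ 2. If $\nu>\tau\big(1-s(0)+\frac{4\eta}{\lambda-2\eta}\big)$, then some $\Delta>0$ satisfies the first condition in 1 and the second one with equality. -/

import Mathlib

open MeasureTheory ProbabilityTheory

/-- The data domain `𝒳 × {0,1} × [p]`: features, label, protected attribute. -/
abbrev DataPt (X : Type*) (p : ℕ) := X × Bool × Fin p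

/-- Binary classifiers, which may in general use the protected attribute. -/
abbrev Classifier (X : Type*) (p : ℕ) := X × Fin p → Bool

/-- A rule for an event "depending on the classifier": for each value `b` of the prediction, the set
of data points at which the event holds if the prediction there is `b`. -/
abbrev EventRule (X : Type*) (p : ℕ) := Bool → Set (DataPt X p)

/-- The hypothesis class `F` shatters the finite set `A`: every subset of `A` is cut out by some
member of `F`. -/
def VCShatters {Y : Type*} (F : Set (Y → Bool)) (A : Finset Y) : Prop :=
  ∀ B : Finset Y, B ⊆ A → ∃ f ∈ F, ∀ a ∈ A, (f a = true ↔ a ∈ B)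

/-- `F` has VC dimension `d`: `d` is the largest size of a finite set shattered by `F`. -/
def HasVCDim {Y : Type*} (F : Set (Y → Bool)) (d : ℕ) : Prop :=
  (∃ A : Finset Y, A.card = d ∧ VCShatters F A) ∧
    ∀ A : Finset Y, VCShatters F A → A.card ≤ d

/-- `F` is a pointwise measurable class: it consists of measurable functions and has a countable
subclass such that every member of `F` is a pointwise limit of a sequence from the subclass. -/
def IsPointwiseMeasurable {Y : Type*} [MeasurableSpace Y] (F : Set (Y → Bool)) : Prop :=
  (∀ f ∈ F, Measurable f) ∧
    ∃ G : Set (Y → Bool), G ⊆ F ∧ G.Countable ∧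
      ∀ f ∈ F, ∃ g : ℕ → (Y → Bool), (∀ n, g n ∈ G) ∧
        ∀ y, Filter.Tendsto (fun n => g n y) Filter.atTop (nhds (f y))

/-- Members of `F` do not use the protected attribute for prediction. -/
def IgnoresProtected {X : Type*} {p : ℕ} (F : Set (Classifier X p)) : Prop :=
  ∀ f ∈ F, ∀ (x : X) (z z' : Fin p), f (x, z) = f (x, z')

noncomputable section

/-- The event `ℰ(f)` given by the rule `E`. -/
def eventOf {X : Type*} {p : ℕ} (E : EventRule X p) (f : Classifier X p) : Set (DataPt X p) :=
  {w | w ∈ E (f (w.1, w.2.2))}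

/-- The event `Z = ℓ`. -/
def groupEv (X : Type*) {p : ℕ} (l : Fin p) : Set (DataPt X p) :=
  {w | w.2.2 = l}

/-- The predictive error `Err_μ(f) = Pr_μ[f(X,Z) ≠ Y]`. -/
def predErr {X : Type*} [MeasurableSpace X] {p : ℕ} (μ : Measure (DataPt X p))
    (f : Classifier X p) : ℝ :=
  μ.real {w | f (w.1, w.2.2) ≠ w.2.1}

/-- The performance `q_ℓ(f) = Pr_μ[ℰ(f) | ℰ'(f), Z = ℓ]`. -/
def groupPerf {X : Type*} [MeasurableSpace X] {p : ℕ} (μ : Measure (DataPt X p))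
    (E E' : EventRule X p) (f : Classifier X p) (l : Fin p) : ℝ :=
  (cond μ (eventOf E' f ∩ groupEv X l)).real (eventOf E f)

/-- The fairness metric `Ω_μ(f) = min_ℓ q_ℓ(f) / max_ℓ q_ℓ(f)`. -/
def fairness {X : Type*} [MeasurableSpace X] {p : ℕ} (μ : Measure (DataPt X p))
    (E E' : EventRule X p) (f : Classifier X p) : ℝ :=
  (⨅ l, groupPerf μ E E' f l) / (⨆ l, groupPerf μ E E' f l)

/-- `Pr_μ[ℰ(f), ℰ'(f), Z = ℓ]`. -/
def jointMass {X : Type*} [MeasurableSpace X] {p : ℕ} (μ : Measure (DataPt X p))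
    (E E' : EventRule X p) (f : Classifier X p) (l : Fin p) : ℝ :=
  μ.real (eventOf E f ∩ eventOf E' f ∩ groupEv X l)

/-- `Pr_μ[ℰ'(f), Z = ℓ]`. -/
def condMass {X : Type*} [MeasurableSpace X] {p : ℕ} (μ : Measure (DataPt X p))
    (E' : EventRule X p) (f : Classifier X p) (l : Fin p) : ℝ :=
  μ.real (eventOf E' f ∩ groupEv X l)

/-- `f` is an optimal solution of the target fair classification program: minimise `Err_𝒟` over
`f ∈ F` subject to `Ω_𝒟(f) ≥ τ`. -/
def IsFairOptimal {X : Type*} [MeasurableSpace X] {p : ℕ} (D : Measure (DataPt X p))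
    (F : Set (Classifier X p)) (E E' : EventRule X p) (τ : ℝ) (f : Classifier X p) : Prop :=
  (f ∈ F ∧ τ ≤ fairness D E E' f) ∧
    ∀ g ∈ F, τ ≤ fairness D E E' g → predErr D f ≤ predErr D g

/-- The empirical distribution of finitely many samples. -/
def empiricalDist {W : Type*} [MeasurableSpace W] {N : ℕ} (S : Fin N → W) : Measure W :=
  (N : ENNReal)⁻¹ • ∑ i, Measure.dirac (S i)

/-- The samples `S` with their protected attributes replaced by `z`. -/
def perturbed {X : Type*} {p N : ℕ} (S : Fin N → DataPt X p) (z : Fin N → Fin p) :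
    Fin N → DataPt X p :=
  fun i => ((S i).1, (S i).2.1, z i)

/-- An adversary with random seed in `R` (it sees all the samples and its seed, and returns the
protected attributes that are shown to the learner) is in the `η`-Hamming model if it changes the
protected attributes of at most `η N` of the `N` samples. -/
def IsHammingAdversary {X R : Type*} {p N : ℕ} (η : ℝ)
    (A : (Fin N → DataPt X p) → R → Fin N → Fin p) : Prop :=
  ∀ (S : Fin N → DataPt X p) (r : R),
    ((Finset.univ.filter fun i => A S r i ≠ (S i).2.2).card : ℝ) ≤ η * N

/-- The optimal value `s` of the auxiliary program with group masses `lam`, `gam` and budget `B`: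
the minimum over `e ≥ 0` with `∑ e ≤ B` and over `ℓ, k` of
`(1 - e_ℓ/λ_ℓ) / (1 + (e_k - e_ℓ)/γ_ℓ) * ((1 + (e_ℓ - e_k)/γ_k) / (1 + e_ℓ/λ_k))`. -/
def auxValue {p : ℕ} (lam gam : Fin p → ℝ) (B : ℝ) : ℝ :=
  sInf {v : ℝ | ∃ e : Fin p → ℝ, (∀ l, 0 ≤ e l) ∧ ∑ l, e l ≤ B ∧ ∃ l k : Fin p,
    v = (1 - e l / lam l) / (1 + (e k - e l) / gam l) *
      ((1 + (e l - e k) / gam k) / (1 + e l / lam k))}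

/-- Feasibility for the program ErrTolerant+ on the empirical distribution `Dhat`, with fairness
threshold `τ * s` and mass thresholds `lam ℓ - η - Δ`. -/
def IsErrTolPlusFeasible {X : Type*} [MeasurableSpace X] {p : ℕ} (Dhat : Measure (DataPt X p))
    (F : Set (Classifier X p)) (E E' : EventRule X p) (lam gam : Fin p → ℝ) (τ η Δ : ℝ)
    (f : Classifier X p) : Prop :=
  f ∈ F ∧ τ * auxValue lam gam (η + Δ) ≤ fairness Dhat E E' f ∧
    ∀ l, lam l - η - Δ ≤ jointMass Dhat E E' f l

/-- `f` is an optimal solution of the program ErrTolerant+: it minimises `Err` on `Dhat` over the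
feasible classifiers. -/
def IsErrTolPlusOptimal {X : Type*} [MeasurableSpace X] {p : ℕ} (Dhat : Measure (DataPt X p))
    (F : Set (Classifier X p)) (E E' : EventRule X p) (lam gam : Fin p → ℝ) (τ η Δ : ℝ)
    (f : Classifier X p) : Prop :=
  IsErrTolPlusFeasible Dhat F E E' lam gam τ η Δ f ∧
    ∀ g, IsErrTolPlusFeasible Dhat F E E' lam gam τ η Δ g → predErr Dhat f ≤ predErr Dhat g

/-- The margin that controls the relaxation parameter:
`min {ε - 2η, ν - τ (1 - s + 4η/(λ - 2η)), λ - 2η}`. -/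
def marginPlus (ε ν τ η lam0 s : ℝ) : ℝ :=
  min (ε - 2 * η) (min (ν - τ * (1 - s + 4 * η / (lam0 - 2 * η))) (lam0 - 2 * η))

end

/-! The clean empirical distribution is uniformly close to `D`, and relabelling samples moves mass
between two groups only in a coupled way.

Uniform convergence. With probability at least `1 - δ`, the errors and, for each group, the masses
of `ℰ ∩ ℰ'` and of `ℰ' \ ℰ` deviate by at most `κ = Δ²/8` over the whole class. This is the
classical VC argument (ghost sample, random swaps, Sauer-Shelah, exponential moments), packaged in
`measure_deviation_le`. Everything after it is deterministic on this event, so the adversary may be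
arbitrary.

Coupled moves. For groups `l ≠ k`, let `e` be the fraction of changed samples that leave `l` or
enter `k`, and `g` the fraction that enter `l` or leave `k`. No changed sample is of both kinds, so
`e + g ≤ η` (`exists_coupled_moves`). With `q = a/(a+b)`, the worst case for `q_l/q_k` is that `a_l`
loses `e`, `b_l` gains `g`, `a_k` gains `e` and `b_k` loses `g`. The factor lost is exactly the
objective of the auxiliary program at `η_l = e`, `η_k = g` (`ratio_transfer`).

The transfer is used twice. From `D` to the perturbed sample, it shows that `fstar` is feasible for
the threshold `τ s`. From the perturbed sample back to `D`, it is applied to a solution: the mass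
constraints bound its group masses below by `m = λ - η - Δ`, so the factor is at least `(m - B)/(m +
B)` with `B = η + 2κ` (`le_ratio_factor`), which is `1 - 4η/(λ - 2η)` up to `Δ`. Prediction errors
are not affected by the adversary, as classifiers ignore the protected attribute.

The second claim is the intermediate value theorem, given continuity of `auxValue` in the budget. -/

/-! ### Growth function and Rademacher moments. -/

/-- The set cut out by the classifier `f` through the rule `R`, where `f` sees `π w`. -/
def ruleSet {W Y : Type*} (π : W → Y) (R : Bool → Set W) (f : Y → Bool) : Set W :=
  {w | w ∈ R (f (π w))}

theorem measurableSet_ruleSet {W Y : Type*} [MeasurableSpace W] [MeasurableSpace Y] {π : W → Y}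
    (hπ : Measurable π) {R : Bool → Set W} (hR : ∀ b, MeasurableSet (R b)) {f : Y → Bool}
    (hf : Measurable f) : MeasurableSet (ruleSet π R f) := by
  have h : ruleSet π R f = ⋃ b, ((fun w => f (π w)) ⁻¹' {b} ∩ R b) := by
    ext w; simp [ruleSet]
  rw [h]
  exact MeasurableSet.iUnion fun b =>
    ((hf.comp hπ) (measurableSet_singleton b)).inter (hR b)

/-- Sauer's bound `∑_{k ≤ d} (n choose k) ≤ (n + 1) ^ d`. -/
theorem sum_choose_le_pow (n d : ℕ) : ∑ k ∈ Finset.Iic d, n.choose k ≤ (n + 1) ^ d := by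
  rw [add_pow, Nat.range_succ_eq_Iic]
  refine Finset.sum_le_sum fun k hk => ?_
  have h1 : 1 ≤ d.choose k := Nat.choose_pos (Finset.mem_Iic.1 hk)
  simpa using Nat.mul_le_mul (Nat.choose_le_pow n k) h1

/-- The number of traces of a VC class on a finite family of points. -/
theorem card_traces_le {Y α : Type*} [Fintype α] [DecidableEq α] {F : Set (Y → Bool)} {d : ℕ}
    (hF : ∀ A : Finset Y, VCShatters F A → A.card ≤ d) (T : α → Y) (U : Finset (Finset α))
    (hU : ∀ u ∈ U, ∃ f ∈ F, ∀ a, a ∈ u ↔ f (T a) = true) :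
    U.card ≤ (Fintype.card α + 1) ^ d := by
  classical
  have hvc : U.vcDim ≤ d := by
    refine Finset.sup_le fun B hB => ?_
    rw [Finset.mem_shatterer] at hB
    -- Indices with the same point lie in the same traces, so a shattered set of indices has
    -- distinct points.
    have hinj : Set.InjOn T (B : Set α) := by
      intro a ha b hb hab
      by_contra hne
      obtain ⟨u, hu, hBu⟩ := hB (t := {a}) (by simpa using ha)
      obtain ⟨f, -, hf⟩ := hU u hu
      have h1 : a ∈ u := (Finset.mem_inter.1 (hBu ▸ Finset.mem_singleton_self a)).2
      have h2 : b ∉ u := fun h => hne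
        (Finset.mem_singleton.1 (hBu ▸ Finset.mem_inter.2 ⟨hb, h⟩)).symm
      rw [hf] at h1 h2
      exact h2 (hab ▸ h1)
    have hsh : VCShatters F (B.image T) := by
      intro C hC
      obtain ⟨u, hu, hBu⟩ := hB (t := B.filter fun a => T a ∈ C) (Finset.filter_subset _ _)
      obtain ⟨f, hfF, hf⟩ := hU u hu
      refine ⟨f, hfF, fun y hy => ?_⟩
      obtain ⟨a, ha, rfl⟩ := Finset.mem_image.1 hy
      rw [← hf]
      have := Finset.ext_iff.1 hBu a
      simp only [Finset.mem_inter, Finset.mem_filter, ha, true_and] at this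
      exact this
    rw [← Finset.card_image_of_injOn hinj]
    exact hF _ hsh
  calc U.card ≤ U.shatterer.card := U.card_le_card_shatterer
    _ ≤ ∑ k ∈ Finset.Iic U.vcDim, (Fintype.card α).choose k := Finset.card_shatterer_le_sum_vcDim
    _ ≤ ∑ k ∈ Finset.Iic d, (Fintype.card α).choose k :=
      Finset.sum_le_sum_of_subset (Finset.Iic_subset_Iic.2 hvc)
    _ ≤ _ := sum_choose_le_pow _ _

/-- The exponential moment of a Rademacher sum with coefficients in `[-1, 1]`. -/
theorem sum_exp_rademacher_le {N : ℕ} (t : ℝ) (v : Fin N → ℝ) (hv : ∀ i, |v i| ≤ 1) :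
    ∑ σ : Fin N → Bool, Real.exp (t * ∑ i, (if σ i then v i else -v i)) ≤
      2 ^ N * Real.exp (N * t ^ 2 / 2) := by
  classical
  have h1 : ∀ σ : Fin N → Bool, Real.exp (t * ∑ i, (if σ i then v i else -v i)) =
      ∏ i, Real.exp (t * (if σ i then v i else -v i)) := fun σ => by
    rw [Finset.mul_sum, Real.exp_sum]
  have h2 := Finset.prod_univ_sum (fun _ : Fin N => (Finset.univ : Finset Bool))
    (fun i b => Real.exp (t * (if b then v i else -v i)))
  rw [Fintype.piFinset_univ] at h2
  simp_rw [h1]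
  rw [← h2]
  have h3 : ∀ i, ∑ b : Bool, Real.exp (t * (if b then v i else -v i)) ≤
      2 * Real.exp (t ^ 2 / 2) := fun i => by
    have h := Real.cosh_le_exp_half_sq (t * v i)
    have h4 : (t * v i) ^ 2 / 2 ≤ t ^ 2 / 2 := by
      have : v i ^ 2 ≤ 1 := (sq_le_one_iff_abs_le_one _).2 (hv i)
      nlinarith [sq_nonneg t]
    have h5 := Real.exp_le_exp.2 h4
    rw [Real.cosh_eq] at h
    simp only [Fintype.sum_bool, if_true, Bool.false_eq_true, if_false, mul_neg]
    linarith
  calc _ ≤ ∏ _i : Fin N, 2 * Real.exp (t ^ 2 / 2) :=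
        Finset.prod_le_prod (fun i _ => Finset.sum_nonneg fun _ _ => (Real.exp_pos _).le)
          fun i _ => h3 i
    _ = 2 ^ N * Real.exp (N * t ^ 2 / 2) := by
        rw [Finset.prod_const, mul_pow, ← Real.exp_nat_mul, Finset.card_univ, Fintype.card_fin]
        ring_nf

/-! ### Symmetrization and the uniform deviation bound. -/

section Symmetrization

variable {W Y : Type*}

/-- The real-valued indicator of `ruleSet π R f`. -/
noncomputable def ruleInd (π : W → Y) (R : Bool → Set W) (f : Y → Bool) : W → ℝ :=
  (ruleSet π R f).indicator fun _ => 1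

theorem ruleInd_congr {π : W → Y} {R : Bool → Set W} {f g : Y → Bool} {w : W}
    (h : f (π w) = g (π w)) : ruleInd π R f w = ruleInd π R g w := by
  classical
  simp [ruleInd, ruleSet, Set.indicator_apply, h]

theorem ruleInd_nonneg (π : W → Y) (R : Bool → Set W) (f : Y → Bool) (w : W) :
    0 ≤ ruleInd π R f w := Set.indicator_nonneg (fun _ _ => zero_le_one) _

theorem ruleInd_le_one (π : W → Y) (R : Bool → Set W) (f : Y → Bool) (w : W) :
    ruleInd π R f w ≤ 1 := Set.indicator_le_self' (fun _ _ => zero_le_one) _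

theorem abs_ruleInd_sub_le (π : W → Y) (R : Bool → Set W) (f : Y → Bool) (w w' : W) :
    |ruleInd π R f w - ruleInd π R f w'| ≤ 1 :=
  abs_sub_le_iff.2 ⟨by linarith [ruleInd_nonneg π R f w', ruleInd_le_one π R f w],
    by linarith [ruleInd_nonneg π R f w, ruleInd_le_one π R f w']⟩

theorem measurable_ruleInd [MeasurableSpace W] [MeasurableSpace Y] {π : W → Y}
    (hπ : Measurable π) {R : Bool → Set W} (hR : ∀ b, MeasurableSet (R b)) {f : Y → Bool}
    (hf : Measurable f) : Measurable (ruleInd π R f) :=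
  measurable_const.indicator (measurableSet_ruleSet hπ hR hf)

/-- The averaged exponential moment of the signed differences, uniformly over a VC class. -/
theorem sum_iSup_exp_swap_le {ι : Type*} (f : ι → Y → Bool) {d : ℕ}
    (hF : ∀ A : Finset Y, VCShatters (Set.range f) A → A.card ≤ d) (π : W → Y)
    (R : Bool → Set W) {N : ℕ} (t : ℝ) (T : Fin N → W × W) :
    ∑ σ : Fin N → Bool, ⨆ j, ENNReal.ofReal (Real.exp (t * ∑ i,
        (ruleInd π R (f j) ((if σ i then id else Prod.swap) (T i)).1 -
          ruleInd π R (f j) ((if σ i then id else Prod.swap) (T i)).2))) ≤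
      2 ^ N * ENNReal.ofReal ((2 * N + 1) ^ d * Real.exp (N * t ^ 2 / 2)) := by
  classical
  -- The sums depend on `j` only through the trace of `f j` on the `2N` points of the double sample.
  -- One representative per trace turns the supremum into a finite sum.
  let P : Fin N × Bool → W := fun a => if a.2 then (T a.1).1 else (T a.1).2
  let tr : ι → Finset (Fin N × Bool) := fun j => Finset.univ.filter fun a => f j (π (P a)) = true
  let U : Finset (Finset (Fin N × Bool)) := Finset.univ.filter fun u => ∃ j, tr j = u
  have hU : U.card ≤ (2 * N + 1) ^ d := by
    have := card_traces_le hF (fun a => π (P a)) U fun u hu => by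
      obtain ⟨j, rfl⟩ := (Finset.mem_filter.1 hu).2
      exact ⟨f j, ⟨j, rfl⟩, fun a => by simp [tr]⟩
    simpa [mul_comm] using this
  have hrep : ∀ u : U, ∃ j, tr j = u := fun u => (Finset.mem_filter.1 u.2).2
  choose rep hrep using hrep
  let v : U → Fin N → ℝ := fun u i =>
    ruleInd π R (f (rep u)) (T i).1 - ruleInd π R (f (rep u)) (T i).2
  have key : ∀ (σ : Fin N → Bool) (j : ι), ∃ u : U, ∑ i,
        (ruleInd π R (f j) ((if σ i then id else Prod.swap) (T i)).1 -
          ruleInd π R (f j) ((if σ i then id else Prod.swap) (T i)).2) =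
        ∑ i, (if σ i then v u i else -v u i) := fun σ j => by
    refine ⟨⟨tr j, Finset.mem_filter.2 ⟨Finset.mem_univ _, j, rfl⟩⟩, ?_⟩
    set u : U := ⟨tr j, Finset.mem_filter.2 ⟨Finset.mem_univ _, j, rfl⟩⟩ with hu
    have hP : ∀ a, f j (π (P a)) = f (rep u) (π (P a)) := fun a => by
      have := Finset.ext_iff.1 (hrep u) a
      simp only [tr, hu, Finset.mem_filter, Finset.mem_univ, true_and] at this
      exact (Bool.eq_iff_iff.2 this).symm
    have h1 : ∀ i, ruleInd π R (f j) (T i).1 = ruleInd π R (f (rep u)) (T i).1 := fun i =>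
      ruleInd_congr (by simpa [P] using hP (i, true))
    have h2 : ∀ i, ruleInd π R (f j) (T i).2 = ruleInd π R (f (rep u)) (T i).2 := fun i =>
      ruleInd_congr (by simpa [P] using hP (i, false))
    refine Finset.sum_congr rfl fun i _ => ?_
    cases σ i <;> simp [v, h1, h2]
  calc _ ≤ ∑ σ : Fin N → Bool, ∑ u : U, ENNReal.ofReal (Real.exp (t * ∑ i,
          (if σ i then v u i else -v u i))) := by
        refine Finset.sum_le_sum fun σ _ => iSup_le fun j => ?_
        obtain ⟨u, hu⟩ := key σ j
        rw [hu]
        exact Finset.single_le_sum (f := fun u : U => ENNReal.ofReal (Real.exp (t * ∑ i,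
          (if σ i then v u i else -v u i)))) (fun _ _ => zero_le) (Finset.mem_univ u)
    _ = ∑ u : U, ENNReal.ofReal (∑ σ : Fin N → Bool, Real.exp (t * ∑ i,
          (if σ i then v u i else -v u i))) := by
        rw [Finset.sum_comm]
        refine Finset.sum_congr rfl fun u _ => ?_
        rw [ENNReal.ofReal_sum_of_nonneg fun _ _ => (Real.exp_pos _).le]
    _ ≤ ∑ _u : U, ENNReal.ofReal (2 ^ N * Real.exp (N * t ^ 2 / 2)) :=
        Finset.sum_le_sum fun u _ => ENNReal.ofReal_le_ofReal
          (sum_exp_rademacher_le t _ fun i => abs_ruleInd_sub_le _ _ _ _ _)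
    _ = ENNReal.ofReal (U.card * (2 ^ N * Real.exp (N * t ^ 2 / 2))) := by
        rw [Finset.sum_const, nsmul_eq_mul, ENNReal.ofReal_mul (Nat.cast_nonneg _),
          ENNReal.ofReal_natCast]
        simp
    _ ≤ ENNReal.ofReal (2 ^ N * ((2 * N + 1) ^ d * Real.exp (N * t ^ 2 / 2))) := by
        refine ENNReal.ofReal_le_ofReal ?_
        have h : (U.card : ℝ) ≤ (2 * N + 1) ^ d := by exact_mod_cast hU
        have h0 : 0 ≤ 2 ^ N * Real.exp (N * t ^ 2 / 2) := by positivity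
        nlinarith [mul_le_mul_of_nonneg_right h h0]
    _ = _ := by
        rw [ENNReal.ofReal_mul (by positivity), ENNReal.ofReal_pow (by norm_num)]
        simp

variable [MeasurableSpace W] [MeasurableSpace Y]

/-- Swapping the two entries of any set of pairs preserves the law, so the integral equals its
average over all `2 ^ N` swaps; these act as random signs on the differences. -/
theorem lintegral_iSup_exp_prod_le {ι : Type*} [Countable ι] (μ : Measure W)
    [IsProbabilityMeasure μ] (f : ι → Y → Bool) (hf : ∀ j, Measurable (f j)) {d : ℕ}
    (hF : ∀ A : Finset Y, VCShatters (Set.range f) A → A.card ≤ d) {π : W → Y}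
    (hπ : Measurable π) {R : Bool → Set W} (hR : ∀ b, MeasurableSet (R b)) (N : ℕ) (t : ℝ) :
    ∫⁻ T, ⨆ j, ENNReal.ofReal (Real.exp (t * ∑ i,
        (ruleInd π R (f j) (T i).1 - ruleInd π R (f j) (T i).2)))
      ∂(Measure.pi fun _ : Fin N => μ.prod μ) ≤
      ENNReal.ofReal ((2 * N + 1) ^ d * Real.exp (N * t ^ 2 / 2)) := by
  have hm := fun j => measurable_ruleInd hπ hR (hf j)
  set Ψ : (Fin N → W × W) → ENNReal := fun T => ⨆ j, ENNReal.ofReal (Real.exp (t * ∑ i,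
        (ruleInd π R (f j) (T i).1 - ruleInd π R (f j) (T i).2))) with hΨ
  have hΨm : Measurable Ψ := by
    refine Measurable.iSup fun j => ?_
    have := hm j
    fun_prop
  have hswap : ∀ σ : Fin N → Bool, MeasurePreserving
      (fun (T : Fin N → W × W) i => (if σ i then id else Prod.swap) (T i))
      (Measure.pi fun _ : Fin N => μ.prod μ) (Measure.pi fun _ : Fin N => μ.prod μ) := fun σ => by
    refine measurePreserving_pi (f := fun i => if σ i then id else Prod.swap) _ _ fun i => ?_
    cases σ i
    · simpa using Measure.measurePreserving_swap
    · simpa using MeasurePreserving.id _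
  have h2 : (2 : ENNReal) ^ N ≠ 0 := by simp
  have h2' : (2 : ENNReal) ^ N ≠ ⊤ := by simp
  refine (ENNReal.mul_le_mul_iff_right h2 h2').1 ?_
  calc 2 ^ N * ∫⁻ T, Ψ T ∂(Measure.pi fun _ : Fin N => μ.prod μ)
      = ∑ σ : Fin N → Bool, ∫⁻ T, Ψ (fun i => (if σ i then id else Prod.swap) (T i))
          ∂(Measure.pi fun _ : Fin N => μ.prod μ) := by
        simp_rw [fun σ => (hswap σ).lintegral_comp hΨm]
        simp
    _ = ∫⁻ T, ∑ σ : Fin N → Bool, Ψ (fun i => (if σ i then id else Prod.swap) (T i))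
          ∂(Measure.pi fun _ : Fin N => μ.prod μ) :=
        (lintegral_finsetSum _ fun σ _ => hΨm.comp (hswap σ).measurable).symm
    _ ≤ ∫⁻ _T, 2 ^ N * ENNReal.ofReal ((2 * N + 1) ^ d * Real.exp (N * t ^ 2 / 2))
          ∂(Measure.pi fun _ : Fin N => μ.prod μ) :=
        lintegral_mono fun T => sum_iSup_exp_swap_le f hF π R t T
    _ = _ := by simp

/-- Replacing the mean by an independent copy increases exponential moments. -/
theorem exp_sub_measure_le_lintegral (μ : Measure W) [IsProbabilityMeasure μ] {f : Y → Bool}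
    (hf : Measurable f) {π : W → Y} (hπ : Measurable π) {R : Bool → Set W}
    (hR : ∀ b, MeasurableSet (R b)) {N : ℕ} (t : ℝ) (S : Fin N → W) :
    ENNReal.ofReal (Real.exp (t * ∑ i, (ruleInd π R f (S i) - μ.real (ruleSet π R f)))) ≤
      ∫⁻ S' : Fin N → W, ENNReal.ofReal (Real.exp (t * ∑ i,
        (ruleInd π R f (S i) - ruleInd π R f (S' i)))) ∂(Measure.pi fun _ => μ) := by
  have hm := measurable_ruleInd hπ hR hf
  set g : (Fin N → W) → ℝ := fun S' => t * ∑ i, (ruleInd π R f (S i) - ruleInd π R f (S' i))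
    with hg
  have hgm : Measurable g := by fun_prop
  have hgb : ∀ S', ‖g S'‖ ≤ |t| * N := fun S' => by
    rw [hg, Real.norm_eq_abs, abs_mul]
    refine mul_le_mul_of_nonneg_left ?_ (abs_nonneg _)
    refine (Finset.abs_sum_le_sum_abs _ _).trans ?_
    refine (Finset.sum_le_sum fun i _ => abs_ruleInd_sub_le π R f (S i) (S' i)).trans ?_
    simp
  have hgi : Integrable g (Measure.pi fun _ => μ) :=
    Integrable.of_bound hgm.aestronglyMeasurable _ (Filter.Eventually.of_forall hgb)
  have hei : Integrable (Real.exp ∘ g) (Measure.pi fun _ => μ) :=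
    Integrable.of_bound (Real.measurable_exp.comp hgm).aestronglyMeasurable
      (Real.exp (|t| * N)) (Filter.Eventually.of_forall fun S' => by
        simp only [Function.comp, Real.norm_eq_abs, Real.abs_exp]
        exact Real.exp_le_exp.2 ((le_abs_self _).trans (hgb S')))
  have hi : ∀ i, Integrable (fun S' : Fin N → W => ruleInd π R f (S' i))
      (Measure.pi fun _ => μ) := fun i =>
    Integrable.of_bound (hm.comp (measurable_pi_apply i)).aestronglyMeasurable 1
      (Filter.Eventually.of_forall fun S' => by
        rw [Real.norm_eq_abs, abs_of_nonneg (ruleInd_nonneg _ _ _ _)]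
        exact ruleInd_le_one _ _ _ _)
  have hint : ∫ S', g S' ∂(Measure.pi fun _ => μ) =
      t * ∑ i, (ruleInd π R f (S i) - μ.real (ruleSet π R f)) := by
    have hs := integral_finsetSum (μ := Measure.pi fun _ : Fin N => μ) Finset.univ
      (f := fun i (S' : Fin N → W) => ruleInd π R f (S i) - ruleInd π R f (S' i))
      fun i _ => (integrable_const _).sub (hi i)
    rw [hg, integral_const_mul, hs]
    congr 1
    refine Finset.sum_congr rfl fun i _ => ?_
    rw [integral_sub (integrable_const _) (hi i),
      integral_comp_eval (μ := fun _ : Fin N => μ) (i := i) hm.aestronglyMeasurable]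
    simp [ruleInd, integral_indicator (measurableSet_ruleSet hπ hR hf)]
  rw [← hint]
  refine le_trans ?_ (ofReal_integral_eq_lintegral_ofReal hei
    (Filter.Eventually.of_forall fun _ => (Real.exp_pos _).le)).le
  exact ENNReal.ofReal_le_ofReal (convexOn_exp.map_integral_le Real.continuous_exp.continuousOn
    isClosed_univ (by simp) hgi hei)

/-- Ghost sample: the mean is replaced by an independent copy, and the supremum of integrals is at
most the integral of the supremum. -/
theorem lintegral_iSup_exp_le {ι : Type*} [Countable ι] (μ : Measure W)
    [IsProbabilityMeasure μ] (f : ι → Y → Bool) (hf : ∀ j, Measurable (f j)) {d : ℕ}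
    (hF : ∀ A : Finset Y, VCShatters (Set.range f) A → A.card ≤ d) {π : W → Y}
    (hπ : Measurable π) {R : Bool → Set W} (hR : ∀ b, MeasurableSet (R b)) (N : ℕ) (t : ℝ) :
    ∫⁻ S, ⨆ j, ENNReal.ofReal (Real.exp (t * ∑ i,
        (ruleInd π R (f j) (S i) - μ.real (ruleSet π R (f j)))))
      ∂(Measure.pi fun _ : Fin N => μ) ≤
      ENNReal.ofReal ((2 * N + 1) ^ d * Real.exp (N * t ^ 2 / 2)) := by
  have hm := fun j => measurable_ruleInd hπ hR (hf j)
  set Φ : (Fin N → W) × (Fin N → W) → ENNReal := fun S => ⨆ j, ENNReal.ofReal (Real.exp (t * ∑ i,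
        (ruleInd π R (f j) (S.1 i) - ruleInd π R (f j) (S.2 i)))) with hΦ
  have hΦm : Measurable Φ := by
    refine Measurable.iSup fun j => ?_
    have := hm j
    fun_prop
  have hmp := measurePreserving_arrowProdEquivProdArrow W W (Fin N) (fun _ => μ) (fun _ => μ)
  calc _ ≤ ∫⁻ S, ∫⁻ S', Φ (S, S') ∂(Measure.pi fun _ : Fin N => μ)
        ∂(Measure.pi fun _ : Fin N => μ) := by
        refine lintegral_mono fun S => iSup_le fun j => ?_
        refine (exp_sub_measure_le_lintegral μ (hf j) hπ hR t S).trans ?_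
        exact lintegral_mono fun S' => le_iSup (fun j => ENNReal.ofReal (Real.exp (t * ∑ i,
          (ruleInd π R (f j) (S i) - ruleInd π R (f j) (S' i))))) j
    _ = ∫⁻ T, Φ T ∂((Measure.pi fun _ : Fin N => μ).prod (Measure.pi fun _ : Fin N => μ)) :=
        (lintegral_prod _ hΦm.aemeasurable).symm
    _ = _ := (hmp.lintegral_comp hΦm).symm
    _ ≤ _ := lintegral_iSup_exp_prod_le μ f hf hF hπ hR N t

/-- Markov's inequality at level `exp (N t²)`. The exponential parameter equals the deviation, and
the sign of `t` selects the tail. -/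
theorem measure_signed_deviation_le {ι : Type*} [Countable ι] (μ : Measure W)
    [IsProbabilityMeasure μ] (f : ι → Y → Bool) (hf : ∀ j, Measurable (f j)) {d : ℕ}
    (hF : ∀ A : Finset Y, VCShatters (Set.range f) A → A.card ≤ d) {π : W → Y}
    (hπ : Measurable π) {R : Bool → Set W} (hR : ∀ b, MeasurableSet (R b)) (N : ℕ) (t : ℝ) :
    (Measure.pi fun _ : Fin N => μ) {S | ∃ j, N * t ^ 2 <
        t * ∑ i, (ruleInd π R (f j) (S i) - μ.real (ruleSet π R (f j)))} ≤
      ENNReal.ofReal ((2 * N + 1) ^ d * Real.exp (-(N * t ^ 2 / 2))) := by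
  have hm := fun j => measurable_ruleInd hπ hR (hf j)
  set Φ : (Fin N → W) → ENNReal := fun S => ⨆ j, ENNReal.ofReal (Real.exp (t * ∑ i,
        (ruleInd π R (f j) (S i) - μ.real (ruleSet π R (f j))))) with hΦ
  have hΦm : Measurable Φ := by
    refine Measurable.iSup fun j => ?_
    have := hm j
    fun_prop
  set a := ENNReal.ofReal (Real.exp (N * t ^ 2)) with ha
  have ha0 : a ≠ 0 := by simp [ha, Real.exp_pos]
  have hsub : {S : Fin N → W | ∃ j, N * t ^ 2 <
        t * ∑ i, (ruleInd π R (f j) (S i) - μ.real (ruleSet π R (f j)))} ⊆ {S | a ≤ Φ S} := by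
    rintro S ⟨j, hj⟩
    exact (ENNReal.ofReal_le_ofReal (Real.exp_le_exp.2 hj.le)).trans
      (le_iSup (fun j => ENNReal.ofReal (Real.exp (t * ∑ i,
        (ruleInd π R (f j) (S i) - μ.real (ruleSet π R (f j)))))) j)
  have h := (mul_meas_ge_le_lintegral hΦm a).trans (lintegral_iSup_exp_le μ f hf hF hπ hR N t)
  refine (measure_mono hsub).trans ((ENNReal.mul_le_mul_iff_right ha0 ENNReal.ofReal_ne_top).1
    (h.trans_eq ?_))
  rw [ha, ← ENNReal.ofReal_mul (Real.exp_pos _).le]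
  congr 1
  rw [mul_left_comm, ← Real.exp_add]
  congr 2
  ring

end Symmetrization

/-- Uniform deviation bound over a pointwise measurable VC class, two-sided. -/
theorem measure_deviation_le {W Y : Type*} [MeasurableSpace W] [MeasurableSpace Y]
    (μ : Measure W) [IsProbabilityMeasure μ] {F : Set (Y → Bool)}
    (hpm : IsPointwiseMeasurable F) {d : ℕ}
    (hF : ∀ A : Finset Y, VCShatters F A → A.card ≤ d) {π : W → Y}
    (hπ : Measurable π) {R : Bool → Set W} (hR : ∀ b, MeasurableSet (R b)) (N : ℕ) {t : ℝ}
    (ht : 0 < t) :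
    (Measure.pi fun _ : Fin N => μ) {S | ∃ f ∈ F, N * t <
        |∑ i, ruleInd π R f (S i) - N * μ.real (ruleSet π R f)|} ≤
      ENNReal.ofReal (2 * ((2 * N + 1) ^ d * Real.exp (-(N * t ^ 2 / 2)))) := by
  obtain ⟨hmeas, G, hGF, hGc, hlim⟩ := hpm
  have : Countable G := hGc
  have hGm : ∀ j : G, Measurable (j : Y → Bool) := fun j => hmeas j (hGF j.2)
  have hGvc : ∀ A : Finset Y, VCShatters (Set.range fun j : G => (j : Y → Bool)) A →
      A.card ≤ d := fun A hA => hF A fun B hB => by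
    obtain ⟨f, ⟨j, rfl⟩, hf⟩ := hA B hB
    exact ⟨j, hGF j.2, hf⟩
  have hp := measure_signed_deviation_le μ (fun j : G => (j : Y → Bool)) hGm hGvc hπ hR N t
  have hn := measure_signed_deviation_le μ (fun j : G => (j : Y → Bool)) hGm hGvc hπ hR N (-t)
  have hsum : ∀ (f : Y → Bool) (S : Fin N → W),
      ∑ i, (ruleInd π R f (S i) - μ.real (ruleSet π R f)) =
        ∑ i, ruleInd π R f (S i) - N * μ.real (ruleSet π R f) := fun f S => by
    simp [Finset.sum_sub_distrib]
  have hsub : {S : Fin N → W | ∃ f ∈ F, N * t <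
        |∑ i, ruleInd π R f (S i) - N * μ.real (ruleSet π R f)|} ⊆
      {S | ∃ j : G, N * t ^ 2 <
        t * ∑ i, (ruleInd π R (j : Y → Bool) (S i) - μ.real (ruleSet π R (j : Y → Bool)))} ∪
      {S | ∃ j : G, N * (-t) ^ 2 <
        -t * ∑ i, (ruleInd π R (j : Y → Bool) (S i) - μ.real (ruleSet π R (j : Y → Bool)))} := by
    rintro S ⟨f, hfF, hf⟩
    obtain ⟨g, hgG, hg⟩ := hlim f hfF
    -- Convergence in `Bool` is eventual equality, so counts and masses of `g n` converge to those
    -- of `f`; a strict deviation of `f` is then shared by some `g n` in the countable subclass.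
    have hev : ∀ y, ∀ᶠ n in Filter.atTop, g n y = f y := fun y => by
      have := hg y
      rwa [nhds_discrete, Filter.tendsto_pure] at this
    have h1 : Filter.Tendsto (fun n => ∑ i, ruleInd π R (g n) (S i)) Filter.atTop
        (nhds (∑ i, ruleInd π R f (S i))) := by
      refine tendsto_finsetSum _ fun i _ => ?_
      refine Filter.Tendsto.congr' ?_ tendsto_const_nhds
      filter_upwards [hev (π (S i))] with n hn
      exact (ruleInd_congr hn).symm
    have h2 : Filter.Tendsto (fun n => μ (ruleSet π R (g n))) Filter.atTop
        (nhds (μ (ruleSet π R f))) := by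
      refine tendsto_measure_of_tendsto_indicator _
        (fun n => measurableSet_ruleSet hπ hR (hmeas _ (hGF (hgG n)))) MeasurableSet.univ
        (measure_ne_top _ _) (by simp) fun w => ?_
      filter_upwards [hev (π w)] with n hn
      simp [ruleSet, hn]
    have h2' : Filter.Tendsto (fun n => μ.real (ruleSet π R (g n))) Filter.atTop
        (nhds (μ.real (ruleSet π R f))) :=
      (ENNReal.tendsto_toReal (measure_ne_top _ _)).comp h2
    have h3 := (h1.sub (h2'.const_mul (N : ℝ))).abs
    obtain ⟨n, hn⟩ := (h3.eventually_const_lt hf).exists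
    rcases lt_abs.1 hn with h | h
    · refine Or.inl ⟨⟨g n, hgG n⟩, ?_⟩
      rw [hsum]
      nlinarith
    · refine Or.inr ⟨⟨g n, hgG n⟩, ?_⟩
      rw [hsum]
      nlinarith
  refine (measure_mono hsub).trans ((measure_union_le _ _).trans ((add_le_add hp hn).trans_eq ?_))
  rw [← ENNReal.ofReal_add (by positivity) (by positivity)]
  congr 1
  rw [neg_sq]
  ring

/-! ### Empirical counts under a Hamming adversary. -/

/-- The empirical mass of `B` is the fraction of the samples that lie in `B`. -/
theorem empiricalDist_real_apply {W : Type*} [MeasurableSpace W] {N : ℕ} (S : Fin N → W)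
    {B : Set W} (hB : MeasurableSet B) :
    (empiricalDist S).real B = (∑ i, B.indicator (fun _ => (1 : ℝ)) (S i)) / N := by
  have h : ∀ i, (Measure.dirac (S i) B).toReal = B.indicator (fun _ => (1 : ℝ)) (S i) := by
    intro i
    rw [Measure.dirac_apply' _ hB]
    by_cases h : S i ∈ B <;> simp [h]
  rw [empiricalDist, Measure.real_def, Measure.smul_apply, Measure.finsetSum_apply, smul_eq_mul,
    ENNReal.toReal_mul, ENNReal.toReal_sum fun i _ => measure_ne_top _ _]
  simp [h, div_eq_inv_mul]

section Moves

variable {X : Type*} {p N : ℕ}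

/-- Between two samples that differ only where the groups differ, in at most `η N` places, the
counts of two groups can only move in a coupled way. -/
theorem exists_coupled_moves {η : ℝ} {S S' : Fin N → DataPt X p}
    (hS : ∀ i, (S i).2.2 = (S' i).2.2 → S i = S' i)
    (hc : ((Finset.univ.filter fun i => (S i).2.2 ≠ (S' i).2.2).card : ℝ) ≤ η * N)
    {l k : Fin p} (hlk : l ≠ k) :
    ∃ e g : ℝ, 0 ≤ e ∧ 0 ≤ g ∧ e + g ≤ η * N ∧
      (∀ B ⊆ groupEv X l,
        ∑ i, B.indicator (fun _ => (1 : ℝ)) (S i) - e ≤ ∑ i, B.indicator (fun _ => (1 : ℝ)) (S' i) ∧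
        ∑ i, B.indicator (fun _ => (1 : ℝ)) (S' i) ≤
          ∑ i, B.indicator (fun _ => (1 : ℝ)) (S i) + g) ∧
      (∀ B ⊆ groupEv X k,
        ∑ i, B.indicator (fun _ => (1 : ℝ)) (S i) - g ≤ ∑ i, B.indicator (fun _ => (1 : ℝ)) (S' i) ∧
        ∑ i, B.indicator (fun _ => (1 : ℝ)) (S' i) ≤
          ∑ i, B.indicator (fun _ => (1 : ℝ)) (S i) + e) := by
  classical
  let ch : Fin N → Prop := fun i => (S i).2.2 ≠ (S' i).2.2
  -- `a` marks changes that leave `l` or enter `k`, `b` those that enter `l` or leave `k`. They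
  -- exclude each other because the group changes and `l ≠ k`.
  let a : Fin N → ℝ := fun i => if ch i ∧ ((S i).2.2 = l ∨ (S' i).2.2 = k) then 1 else 0
  let b : Fin N → ℝ := fun i => if ch i ∧ ((S' i).2.2 = l ∨ (S i).2.2 = k) then 1 else 0
  have ha : ∀ i, 0 ≤ a i := fun i => by simp only [a]; split_ifs <;> norm_num
  have hb : ∀ i, 0 ≤ b i := fun i => by simp only [b]; split_ifs <;> norm_num
  have hab : ∀ i, a i + b i ≤ if ch i then 1 else 0 := fun i => by
    simp only [a, b, ch]
    split_ifs with h1 h2 h3 h4 h5 <;> simp_all <;> grind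
  have hpt : ∀ (B : Set (DataPt X p)) (i : Fin N),
      (B ⊆ groupEv X l → B.indicator (fun _ => (1 : ℝ)) (S i) - a i ≤ B.indicator (fun _ => 1) (S' i)
        ∧ B.indicator (fun _ => (1 : ℝ)) (S' i) ≤ B.indicator (fun _ => 1) (S i) + b i) ∧
      (B ⊆ groupEv X k → B.indicator (fun _ => (1 : ℝ)) (S i) - b i ≤ B.indicator (fun _ => 1) (S' i)
        ∧ B.indicator (fun _ => (1 : ℝ)) (S' i) ≤ B.indicator (fun _ => 1) (S i) + a i) := by
    intro B i
    by_cases hi : ch i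
    · constructor <;> intro hB
      all_goals
        have h1 : S i ∈ B → (S i).2.2 = _ := fun h => hB h
        have h2 : S' i ∈ B → (S' i).2.2 = _ := fun h => hB h
        by_cases m1 : S i ∈ B <;> by_cases m2 : S' i ∈ B <;>
          simp only [m1, m2, forall_true_left, Set.indicator_of_mem, Set.indicator_of_notMem,
            not_false_eq_true] at h1 h2 ⊢ <;>
          simp [a, b, hi, h1, h2] <;> (try constructor) <;> (try split_ifs) <;> norm_num
    · rw [hS i (not_not.1 hi)]
      have := ha i
      have := hb i
      refine ⟨fun _ => ⟨?_, ?_⟩, fun _ => ⟨?_, ?_⟩⟩ <;> linarith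
  refine ⟨∑ i, a i, ∑ i, b i, Finset.sum_nonneg fun i _ => ha i, Finset.sum_nonneg fun i _ => hb i,
    ?_, fun B hB => ?_, fun B hB => ?_⟩
  · rw [← Finset.sum_add_distrib]
    refine (Finset.sum_le_sum fun i _ => hab i).trans ?_
    refine le_of_eq_of_le ?_ hc
    rw [Finset.sum_boole]
  · rw [← Finset.sum_add_distrib, ← Finset.sum_sub_distrib]
    exact ⟨Finset.sum_le_sum fun i _ => ((hpt B i).1 hB).1,
      Finset.sum_le_sum fun i _ => ((hpt B i).1 hB).2⟩
  · rw [← Finset.sum_add_distrib, ← Finset.sum_sub_distrib]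
    exact ⟨Finset.sum_le_sum fun i _ => ((hpt B i).2 hB).1,
      Finset.sum_le_sum fun i _ => ((hpt B i).2 hB).2⟩

/-- Between two samples that differ in at most `η N` places, no count moves by more than `η N`. -/
theorem abs_sum_indicator_sub_le {η : ℝ} {S S' : Fin N → DataPt X p}
    (hS : ∀ i, (S i).2.2 = (S' i).2.2 → S i = S' i)
    (hc : ((Finset.univ.filter fun i => (S i).2.2 ≠ (S' i).2.2).card : ℝ) ≤ η * N)
    (B : Set (DataPt X p)) :
    |∑ i, B.indicator (fun _ => (1 : ℝ)) (S' i) - ∑ i, B.indicator (fun _ => (1 : ℝ)) (S i)| ≤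
      η * N := by
  classical
  rw [← Finset.sum_sub_distrib]
  refine (Finset.abs_sum_le_sum_abs _ _).trans (le_trans ?_ hc)
  rw [← Finset.sum_boole]
  refine Finset.sum_le_sum fun i _ => ?_
  split_ifs with h
  · by_cases m1 : S i ∈ B <;> by_cases m2 : S' i ∈ B <;> simp [m1, m2]
  · rw [hS i (not_not.1 h)]
    simp

end Moves

/-! ### Real inequalities for ratios of performances. -/

section Ratios

/-- The factor by which the ratio of the performances `a / (a + b)` and `a₂ / (a₂ + b₂)` of two
groups drops at most under coupled moves of sizes `e`, `g`. -/
theorem ratio_transfer {t a b a₂ b₂ e g a' b' a₂' b₂' : ℝ} (he : 0 ≤ e) (hg : 0 ≤ g)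
    (hea : e < a) (hga : g < a₂) (hb : 0 ≤ b) (hb₂ : 0 ≤ b₂) (hb' : 0 ≤ b')
    (ha₂' : 0 ≤ a₂') (hb₂' : 0 ≤ b₂') (h1 : a - e ≤ a') (h2 : b' ≤ b + g) (h3 : a₂' ≤ a₂ + e)
    (h4 : b₂ - g ≤ b₂') (ht : 0 ≤ t) (h : t * (a₂ / (a₂ + b₂)) ≤ a / (a + b)) :
    t * ((1 - e / a) / (1 + (g - e) / (a + b)) * ((1 + (e - g) / (a₂ + b₂)) / (1 + e / a₂))) *
      (a₂' / (a₂' + b₂')) ≤ a' / (a' + b') := by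
  have ha : 0 < a := he.trans_lt hea
  have ha₂ : 0 < a₂ := hg.trans_lt hga
  have hab : 0 < a + b := by linarith
  have hab₂ : 0 < a₂ + b₂ := by linarith
  have hd : 0 < a + b + g - e := by linarith
  have hd₂ : 0 < a₂ + b₂ + e - g := by linarith
  set x := (1 - e / a) / (1 + (g - e) / (a + b)) with hx
  set y := (1 + (e - g) / (a₂ + b₂)) / (1 + e / a₂) with hy
  have hx1 : a / (a + b) * x = (a - e) / (a + b + g - e) := by
    rw [hx, show 1 - e / a = (a - e) / a by field_simp,
      show 1 + (g - e) / (a + b) = (a + b + g - e) / (a + b) by field_simp; ring]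
    field_simp
  have hy0 : y = ((a₂ + b₂ + e - g) / (a₂ + b₂)) / ((a₂ + e) / a₂) := by
    rw [hy, show 1 + (e - g) / (a₂ + b₂) = (a₂ + b₂ + e - g) / (a₂ + b₂) by field_simp; ring,
      show 1 + e / a₂ = (a₂ + e) / a₂ by field_simp]
  have hypos : 0 ≤ y := by rw [hy0]; positivity
  have hy1 : y * ((a₂ + e) / (a₂ + b₂ + e - g)) = a₂ / (a₂ + b₂) := by
    rw [hy0]
    field_simp
  have hxpos : 0 ≤ x := by
    have h5 : 0 ≤ a / (a + b) * x := by rw [hx1]; exact div_nonneg (by linarith) hd.le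
    have h6 : 0 < a / (a + b) := by positivity
    exact nonneg_of_mul_nonneg_right h5 h6
  have hq1 : (a - e) / (a + b + g - e) ≤ a' / (a' + b') := by
    rw [div_le_div_iff₀ hd (by linarith)]
    nlinarith [mul_nonneg (sub_nonneg.2 h1) (by linarith : 0 ≤ b + g),
      mul_nonneg (sub_nonneg.2 h2) (by linarith : 0 ≤ a - e)]
  have hq2 : a₂' / (a₂' + b₂') ≤ (a₂ + e) / (a₂ + b₂ + e - g) := by
    rcases ha₂'.eq_or_lt with h0 | h0
    · rw [← h0, zero_div]; exact div_nonneg (by linarith) hd₂.le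
    rw [div_le_div_iff₀ (by linarith) hd₂]
    -- If `b₂ ≤ g`, the right-hand bound is at least `1` and the claim is trivial.
    rcases le_total (b₂ - g) 0 with h5 | h5
    · nlinarith [mul_nonneg ha₂' (neg_nonneg.2 h5), mul_nonneg (by linarith : 0 ≤ a₂ + e) hb₂']
    · nlinarith [mul_nonneg (sub_nonneg.2 h3) h5,
        mul_nonneg (sub_nonneg.2 h4) (by linarith : 0 ≤ a₂ + e)]
  calc t * (x * y) * (a₂' / (a₂' + b₂')) = t * x * (y * (a₂' / (a₂' + b₂'))) := by ring
    _ ≤ t * x * (y * ((a₂ + e) / (a₂ + b₂ + e - g))) := by gcongr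
    _ = x * (t * (a₂ / (a₂ + b₂))) := by rw [hy1]; ring
    _ ≤ x * (a / (a + b)) := by gcongr
    _ = (a - e) / (a + b + g - e) := by rw [mul_comm, hx1]
    _ ≤ _ := hq1

/-- If `e ≤ g`, every mass can be replaced by `m`, giving `(m² - gm + x)/(m² + gm + x)` with `x =
e(g - e) ≥ 0`, which is at least `(m - g)/(m + g)`. If `g ≤ e`, the terms with `c` and `c₂` only
help and `(m - e)/(m + e)` remains. The larger move is at most `B`. -/
theorem le_ratio_factor {m B a c a₂ c₂ e g : ℝ} (he : 0 ≤ e) (hg : 0 ≤ g) (heg : e + g ≤ B)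
    (hB : B < m) (ha : m ≤ a) (hac : a ≤ c) (ha₂ : m ≤ a₂) (hac₂ : a₂ ≤ c₂) :
    (m - B) / (m + B) ≤
      (1 - e / a) / (1 + (g - e) / c) * ((1 + (e - g) / c₂) / (1 + e / a₂)) := by
  have hm : 0 < m := by linarith
  have ha0 : 0 < a := by linarith
  have hc0 : 0 < c := by linarith
  have ha₂0 : 0 < a₂ := by linarith
  have hc₂0 : 0 < c₂ := by linarith
  have hgB : (m - B) / (m + B) ≤ (m - (e + g)) / (m + (e + g)) := by
    rw [div_le_div_iff₀ (by linarith) (by linarith)]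
    nlinarith
  have h1 : (m - e) / m ≤ 1 - e / a := by
    rw [show 1 - e / a = (a - e) / a by field_simp, div_le_div_iff₀ hm (by linarith)]
    nlinarith
  have h2 : 1 + e / a₂ ≤ (m + e) / m := by
    rw [show 1 + e / a₂ = (a₂ + e) / a₂ by field_simp, div_le_div_iff₀ (by linarith) hm]
    nlinarith
  have h2p : 0 < 1 + e / a₂ := by
    have : 0 ≤ e / a₂ := div_nonneg he (by linarith)
    linarith
  have h0 : 0 < (m - e) / m := div_pos (by linarith) hm
  have h1p : 0 ≤ 1 - e / a := h0.le.trans h1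
  refine hgB.trans ?_
  rcases le_total e g with h | h
  · have h3 : 1 + (g - e) / c ≤ (m + (g - e)) / m := by
      rw [show 1 + (g - e) / c = (c + (g - e)) / c by field_simp,
        div_le_div_iff₀ (by linarith) hm]
      nlinarith
    have h3p : 0 < 1 + (g - e) / c := by
      have : 0 ≤ (g - e) / c := div_nonneg (by linarith) (by linarith)
      linarith
    have h4 : (m - (g - e)) / m ≤ 1 + (e - g) / c₂ := by
      rw [show 1 + (e - g) / c₂ = (c₂ - (g - e)) / c₂ by field_simp; ring,
        div_le_div_iff₀ hm (by linarith)]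
      nlinarith
    have h40 : 0 ≤ (m - (g - e)) / m := div_nonneg (by linarith) hm.le
    have h4p := h40.trans h4
    calc (m - (e + g)) / (m + (e + g)) ≤ (m - g) / (m + g) := by
          rw [div_le_div_iff₀ (by linarith) (by linarith)]; nlinarith
      _ ≤ ((m - e) / m) / ((m + (g - e)) / m) * (((m - (g - e)) / m) / ((m + e) / m)) := by
          have h5 : ((m - e) / m) / ((m + (g - e)) / m) * (((m - (g - e)) / m) / ((m + e) / m)) =
              ((m - e) * (m - (g - e))) / ((m + (g - e)) * (m + e)) := by
            have : m + (g - e) ≠ 0 := by linarith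
            field_simp
          rw [h5, div_le_div_iff₀ (by linarith) (mul_pos (by linarith) (by linarith))]
          have : 0 ≤ e * (g - e) := mul_nonneg he (by linarith)
          nlinarith [mul_nonneg this hg]
      _ ≤ _ := mul_le_mul (div_le_div₀ h1p h1 h3p h3) (div_le_div₀ h4p h4 h2p h2)
          (div_nonneg h40 (by positivity)) (div_nonneg h1p h3p.le)
  · have h3 : 1 + (g - e) / c ≤ 1 := by
      have : (g - e) / c ≤ 0 := div_nonpos_of_nonpos_of_nonneg (by linarith) (by linarith)
      linarith
    have h3p : 0 < 1 + (g - e) / c := by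
      rw [show 1 + (g - e) / c = (c + (g - e)) / c by field_simp]
      exact div_pos (by linarith) (by linarith)
    have h4 : 1 ≤ 1 + (e - g) / c₂ := by
      have : 0 ≤ (e - g) / c₂ := div_nonneg (by linarith) (by linarith)
      linarith
    calc (m - (e + g)) / (m + (e + g)) ≤ (m - e) / (m + e) := by
          rw [div_le_div_iff₀ (by linarith) (by linarith)]; nlinarith
      _ = ((m - e) / m) / 1 * (1 / ((m + e) / m)) := by field_simp
      _ ≤ _ := mul_le_mul (div_le_div₀ h1p h1 h3p h3)
          (div_le_div₀ (by linarith) h4 h2p h2) (by positivity) (div_nonneg h1p h3p.le)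

/-- With losses below all group masses, the terms of the auxiliary program are nonnegative. -/
theorem aux_term_nonneg {a c a₂ c₂ e g : ℝ} (he : 0 ≤ e) (hg : 0 ≤ g) (hea : e ≤ a) (hac : a ≤ c)
    (hgc : g ≤ c₂) (hc : 0 < c) (ha₂ : 0 < a₂) (hc₂ : 0 < c₂) :
    0 ≤ (1 - e / a) / (1 + (g - e) / c) * ((1 + (e - g) / c₂) / (1 + e / a₂)) := by
  have h1 : 0 ≤ 1 - e / a := sub_nonneg.2 (div_le_one_of_le₀ hea (he.trans hea))
  have h2 : 0 ≤ 1 + (g - e) / c := by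
    rw [show 1 + (g - e) / c = (c + (g - e)) / c by field_simp]
    exact div_nonneg (by linarith) hc.le
  have h3 : 0 ≤ 1 + (e - g) / c₂ := by
    rw [show 1 + (e - g) / c₂ = (c₂ + (e - g)) / c₂ by field_simp]
    exact div_nonneg (by linarith) hc₂.le
  have h4 : 0 ≤ 1 + e / a₂ := by positivity
  positivity

end Ratios

/-! ### Fairness as pairwise inequalities, and its transfer between measures. -/

section Fairness

variable {X : Type*} [MeasurableSpace X] {p : ℕ}

theorem groupPerf_nonneg (μ : Measure (DataPt X p)) (E E' : EventRule X p) (f : Classifier X p)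
    (l : Fin p) : 0 ≤ groupPerf μ E E' f l := measureReal_nonneg

theorem mul_groupPerf_le_of_le_fairness {μ : Measure (DataPt X p)} {E E' : EventRule X p}
    {f : Classifier X p} {t : ℝ} (h : t ≤ fairness μ E E' f) (l k : Fin p) :
    t * groupPerf μ E E' f k ≤ groupPerf μ E E' f l := by
  have hk := groupPerf_nonneg μ E E' f k
  have hl := groupPerf_nonneg μ E E' f l
  have h1 : groupPerf μ E E' f k ≤ ⨆ l, groupPerf μ E E' f l :=
    le_ciSup (Set.finite_range _).bddAbove k
  have h2 : ⨅ l, groupPerf μ E E' f l ≤ groupPerf μ E E' f l :=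
    ciInf_le (Set.finite_range _).bddBelow l
  rcases hk.eq_or_lt with h0 | h0
  · rw [← h0, mul_zero]; exact hl
  rcases le_total t 0 with ht | ht
  · exact (mul_nonpos_of_nonpos_of_nonneg ht hk).trans hl
  rw [fairness, le_div_iff₀ (h0.trans_le h1)] at h
  exact ((mul_le_mul_of_nonneg_left h1 ht).trans h).trans h2

/-- One positive performance is required: if all vanish, the pairwise inequalities hold for every
`t`, while the fairness is `0 / 0 = 0`. -/
theorem le_fairness {μ : Measure (DataPt X p)} {E E' : EventRule X p}
    {f : Classifier X p} {t : ℝ} (k₀ : Fin p) (hpos : 0 < groupPerf μ E E' f k₀)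
    (h : ∀ l k, t * groupPerf μ E E' f k ≤ groupPerf μ E E' f l) : t ≤ fairness μ E E' f := by
  have : Nonempty (Fin p) := ⟨k₀⟩
  obtain ⟨k, hk⟩ := exists_eq_ciSup_of_finite (f := groupPerf μ E E' f)
  have h1 : groupPerf μ E E' f k₀ ≤ ⨆ l, groupPerf μ E E' f l :=
    le_ciSup (Set.finite_range _).bddAbove k₀
  rw [fairness, le_div_iff₀ (hpos.trans_le h1), ← hk]
  exact le_ciInf fun l => h l k

/-- The mass of the points of group `l` in `ℰ'(f)` but not in `ℰ(f)`. -/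
noncomputable def missMass (μ : Measure (DataPt X p)) (E E' : EventRule X p)
    (f : Classifier X p) (l : Fin p) : ℝ :=
  μ.real ((eventOf E' f \ eventOf E f) ∩ groupEv X l)

theorem measurableSet_groupEv (l : Fin p) : MeasurableSet (groupEv X l) :=
  measurable_snd.snd (measurableSet_singleton l)

theorem measurableSet_eventOf {E : EventRule X p} (hE : ∀ b, MeasurableSet (E b))
    {f : Classifier X p} (hf : Measurable f) : MeasurableSet (eventOf E f) :=
  measurableSet_ruleSet (by fun_prop) hE hf

variable (μ : Measure (DataPt X p)) [IsFiniteMeasure μ] {E E' : EventRule X p}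
  {f : Classifier X p}

theorem condMass_eq (hE : MeasurableSet (eventOf E f)) (l : Fin p) :
    condMass μ E' f l = jointMass μ E E' f l + missMass μ E E' f l := by
  rw [condMass, jointMass, missMass, ← measureReal_inter_add_sdiff (s := eventOf E' f ∩ groupEv X l) hE]
  congr 2 <;> ext w <;> simp only [Set.mem_inter_iff, Set.mem_sdiff] <;> tauto

theorem groupPerf_eq (hE : MeasurableSet (eventOf E f)) (hE' : MeasurableSet (eventOf E' f))
    (l : Fin p) :
    groupPerf μ E E' f l =
      jointMass μ E E' f l / (jointMass μ E E' f l + missMass μ E E' f l) := by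
  rw [← condMass_eq μ hE, groupPerf, measureReal_def,
    cond_apply (hE'.inter (measurableSet_groupEv l)), ENNReal.toReal_mul, ENNReal.toReal_inv,
    ← measureReal_def, ← measureReal_def, condMass, jointMass, div_eq_inv_mul]
  congr 2
  ext w; simp only [Set.mem_inter_iff]; tauto

theorem jointMass_nonneg (μ : Measure (DataPt X p)) (E E' : EventRule X p) (f : Classifier X p)
    (l : Fin p) : 0 ≤ jointMass μ E E' f l := measureReal_nonneg

theorem missMass_nonneg (μ : Measure (DataPt X p)) (E E' : EventRule X p) (f : Classifier X p)
    (l : Fin p) : 0 ≤ missMass μ E E' f l := measureReal_nonneg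

/-- The masses of any two groups under `μ` and `ν` differ by coupled moves of total size `B`. -/
def CoupledMasses (μ ν : Measure (DataPt X p)) (E E' : EventRule X p) (f : Classifier X p)
    (B : ℝ) : Prop :=
  ∀ l k : Fin p, l ≠ k → ∃ e g : ℝ, 0 ≤ e ∧ 0 ≤ g ∧ e + g ≤ B ∧
    jointMass μ E E' f l - e ≤ jointMass ν E E' f l ∧
    missMass ν E E' f l ≤ missMass μ E E' f l + g ∧
    jointMass ν E E' f k ≤ jointMass μ E E' f k + e ∧
    missMass μ E E' f k - g ≤ missMass ν E E' f k

/-- Stated for two arbitrary finite measures so as to serve in both directions between `D` and the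
perturbed sample. The threshold `s` only has to lie below `t` times the factor of every admissible
pair of moves. -/
theorem le_fairness_of_coupledMasses {μ ν : Measure (DataPt X p)} [IsFiniteMeasure μ]
    [IsFiniteMeasure ν] (hp : 0 < p)
    (hE : MeasurableSet (eventOf E f)) (hE' : MeasurableSet (eventOf E' f)) {B t s : ℝ}
    (hc : CoupledMasses μ ν E E' f B) (ht : 0 ≤ t)
    (hB : ∀ l, B < jointMass μ E E' f l) (hν : ∀ l, 0 < jointMass ν E E' f l)
    (hst : ∀ l k : Fin p, l ≠ k → ∀ e g : ℝ, 0 ≤ e → 0 ≤ g → e + g ≤ B → s ≤ t *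
      ((1 - e / jointMass μ E E' f l) /
        (1 + (g - e) / (jointMass μ E E' f l + missMass μ E E' f l)) *
      ((1 + (e - g) / (jointMass μ E E' f k + missMass μ E E' f k)) /
        (1 + e / jointMass μ E E' f k))))
    (hs1 : s ≤ 1)
    (h : t ≤ fairness μ E E' f) : s ≤ fairness ν E E' f := by
  have hpos : ∀ l, 0 < groupPerf ν E E' f l := fun l => by
    rw [groupPerf_eq ν hE hE']
    exact div_pos (hν l) (add_pos_of_pos_of_nonneg (hν l) (missMass_nonneg _ _ _ _ _))
  refine le_fairness ⟨0, hp⟩ (hpos _) fun l k => ?_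
  by_cases hlk : l = k
  · subst hlk
    nlinarith [hpos l]
  obtain ⟨e, g, he, hg, heg, h1, h2, h3, h4⟩ := hc l k hlk
  have h5 := mul_groupPerf_le_of_le_fairness h l k
  have h6 := hst l k hlk e g he hg heg
  refine (mul_le_mul_of_nonneg_right h6 (hpos k).le).trans ?_
  rw [groupPerf_eq ν hE hE', groupPerf_eq ν hE hE']
  rw [groupPerf_eq μ hE hE', groupPerf_eq μ hE hE'] at h5
  exact ratio_transfer he hg (by linarith [hB l]) (by linarith [hB k]) (missMass_nonneg _ _ _ _ _)
    (missMass_nonneg _ _ _ _ _) (missMass_nonneg _ _ _ _ _) (jointMass_nonneg _ _ _ _ _)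
    (missMass_nonneg _ _ _ _ _) h1 h2 h3 h4 ht h5

end Fairness

/-! ### Bounds and continuity for the auxiliary program. -/

section AuxValue

variable {p : ℕ} {lam gam : Fin p → ℝ} {B : ℝ}

theorem auxValue_set_nonneg (hB : ∀ l, B < lam l) (hlg : ∀ l, lam l ≤ gam l) (hB0 : 0 ≤ B) :
    ∀ v ∈ {v : ℝ | ∃ e : Fin p → ℝ, (∀ l, 0 ≤ e l) ∧ ∑ l, e l ≤ B ∧ ∃ l k : Fin p,
    v = (1 - e l / lam l) / (1 + (e k - e l) / gam l) *
      ((1 + (e l - e k) / gam k) / (1 + e l / lam k))}, 0 ≤ v := by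
  rintro v ⟨e, he, hs, l, k, rfl⟩
  have hle : ∀ l, e l ≤ B := fun l =>
    (Finset.single_le_sum (fun i _ => he i) (Finset.mem_univ l)).trans hs
  exact aux_term_nonneg (he l) (he k) (by linarith [hle l, hB l]) (hlg l)
    (by linarith [hle k, hB k, hlg k]) (by linarith [hB l, hlg l]) (by linarith [hB k])
    (by linarith [hB k, hlg k])

theorem auxValue_nonneg (hB : ∀ l, B < lam l) (hlg : ∀ l, lam l ≤ gam l) (hB0 : 0 ≤ B) :
    0 ≤ auxValue lam gam B :=
  Real.sInf_nonneg (auxValue_set_nonneg hB hlg hB0)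

theorem auxValue_le_one (hp : 0 < p) (hB : ∀ l, B < lam l) (hlg : ∀ l, lam l ≤ gam l)
    (hB0 : 0 ≤ B) : auxValue lam gam B ≤ 1 :=
  csInf_le ⟨0, auxValue_set_nonneg hB hlg hB0⟩
    ⟨0, by simp, by simpa using hB0, ⟨0, hp⟩, ⟨0, hp⟩, by simp⟩

/-- Coupled moves form an admissible vector supported on `l` and `k`; the joint bound `e + g ≤ B` is
what makes it admissible. -/
theorem auxValue_le (hB : ∀ l, B < lam l) (hlg : ∀ l, lam l ≤ gam l) (hB0 : 0 ≤ B) {l k : Fin p}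
    (hlk : l ≠ k) {e g : ℝ} (he : 0 ≤ e) (hg : 0 ≤ g) (heg : e + g ≤ B) :
    auxValue lam gam B ≤ (1 - e / lam l) / (1 + (g - e) / gam l) *
      ((1 + (e - g) / gam k) / (1 + e / lam k)) := by
  refine csInf_le ⟨0, auxValue_set_nonneg hB hlg hB0⟩
    ⟨fun i => (if i = l then e else 0) + (if i = k then g else 0), fun i => ?_, ?_, l, k, ?_⟩
  · dsimp only; split_ifs <;> positivity
  · simpa [Finset.sum_add_distrib] using heg
  · simp [hlk, hlk.symm]

/-- The value of the auxiliary program depends continuously on a budget below all group masses. -/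
theorem continuousOn_auxValue {lo hi : ℝ} (hlo : 0 < lo) (hhi : ∀ l, hi < lam l)
    (hlg : ∀ l, lam l ≤ gam l) : ContinuousOn (auxValue lam gam) (Set.Icc lo hi) := by
  rw [continuousOn_iff_continuous_domRestrict]
  -- Writing the losses as `B` times a vector of total at most `1` makes the feasible set a compact
  -- `K` independent of `B`; the infimum of a jointly continuous function over it is continuous.
  -- Undoing the scaling needs `B > 0`, hence `0 < lo`.
  let K : Set ((Fin p → ℝ) × Fin p × Fin p) :=
    {x | (∀ l, 0 ≤ x.1 l) ∧ ∑ l, x.1 l ≤ 1}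
  have hle : ∀ x ∈ K, ∀ l, x.1 l ≤ 1 := fun x hx l =>
    (Finset.single_le_sum (fun i _ => hx.1 i) (Finset.mem_univ l)).trans hx.2
  have hK : IsCompact K := by
    have hcl : IsClosed {e : Fin p → ℝ | (∀ l, 0 ≤ e l) ∧ ∑ l, e l ≤ 1} := by
      refine IsClosed.and ?_ (isClosed_le (by fun_prop) continuous_const)
      simp only [Set.ofPred_forall]
      exact isClosed_iInter fun l => isClosed_le continuous_const (continuous_apply l)
    have hcpt : IsCompact {e : Fin p → ℝ | (∀ l, 0 ≤ e l) ∧ ∑ l, e l ≤ 1} := by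
      refine (isCompact_univ_pi fun _ : Fin p => isCompact_Icc (a := (0 : ℝ)) (b := 1)).of_isClosed_subset
        hcl fun e he l _ => ⟨he.1 l, ?_⟩
      exact (Finset.single_le_sum (fun i _ => he.1 i) (Finset.mem_univ l)).trans he.2
    have : K = {e : Fin p → ℝ | (∀ l, 0 ≤ e l) ∧ ∑ l, e l ≤ 1} ×ˢ Set.univ := by
      ext x; simp [K]
    rw [this]
    exact hcpt.prod isCompact_univ
  let φ : Set.Icc lo hi → K → ℝ := fun B x =>
    (1 - (B * x.1.1 x.1.2.1) / lam x.1.2.1) /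
        (1 + (B * x.1.1 x.1.2.2 - B * x.1.1 x.1.2.1) / gam x.1.2.1) *
      ((1 + (B * x.1.1 x.1.2.1 - B * x.1.1 x.1.2.2) / gam x.1.2.2) /
        (1 + (B * x.1.1 x.1.2.1) / lam x.1.2.2))
  have hφ : Continuous (Function.uncurry φ) := by
    have hev : ∀ j : (Set.Icc lo hi) × K → Fin p, Continuous j →
        Continuous fun y : (Set.Icc lo hi) × K => (y.1 : ℝ) * y.2.1.1 (j y) := fun j hj => by
      refine (continuous_subtype_val.comp continuous_fst).mul ?_
      rw [continuous_iff_continuousAt]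
      intro y
      have h1 : ∀ᶠ y' in nhds y, j y' = j y := by
        have := hj.tendsto y
        rwa [nhds_discrete (Fin p), Filter.tendsto_pure] at this
      have h2 : Continuous fun y' : (Set.Icc lo hi) × K => y'.2.1.1 (j y) := by fun_prop
      exact h2.continuousAt.congr (h1.mono fun y' h => by simp only [h])
    have hd : ∀ (c : Fin p → ℝ) (j : (Set.Icc lo hi) × K → Fin p), Continuous j →
        Continuous fun y : (Set.Icc lo hi) × K => c (j y) := fun c j hj =>
      (continuous_of_discreteTopology : Continuous c).comp hj
    have hl : Continuous fun y : (Set.Icc lo hi) × K => y.2.1.2.1 := by fun_prop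
    have hk : Continuous fun y : (Set.Icc lo hi) × K => y.2.1.2.2 := by fun_prop
    have hb : ∀ (y : (Set.Icc lo hi) × K) (l : Fin p), 0 ≤ (y.1 : ℝ) * y.2.1.1 l ∧
        (y.1 : ℝ) * y.2.1.1 l < lam l := fun y l => by
      have h1 := y.1.2
      have h2 := hle y.2.1 y.2.2 l
      have h3 := y.2.2.1 l
      have h4 := hhi l
      refine ⟨mul_nonneg (hlo.le.trans h1.1) h3, ?_⟩
      nlinarith [h1.1, h1.2]
    have hlam : ∀ (y : (Set.Icc lo hi) × K) (l : Fin p), 0 < lam l := fun y l => by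
      linarith [(hb y l).1, (hb y l).2]
    have hgam : ∀ (y : (Set.Icc lo hi) × K) (l : Fin p), 0 < gam l := fun y l =>
      (hlam y l).trans_le (hlg l)
    have hden : ∀ (y : (Set.Icc lo hi) × K) (l k : Fin p),
        1 + ((y.1 : ℝ) * y.2.1.1 k - y.1 * y.2.1.1 l) / gam l ≠ 0 := fun y l k => by
      have h1 := hgam y l
      rw [show 1 + ((y.1 : ℝ) * y.2.1.1 k - y.1 * y.2.1.1 l) / gam l =
        (gam l + (y.1 * y.2.1.1 k - y.1 * y.2.1.1 l)) / gam l by field_simp]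
      refine (div_pos ?_ h1).ne'
      linarith [(hb y l).2, (hb y k).1, hlg l]
    have hden' : ∀ (y : (Set.Icc lo hi) × K) (l k : Fin p),
        1 + ((y.1 : ℝ) * y.2.1.1 l) / lam k ≠ 0 := fun y l k => by
      have := div_nonneg (hb y l).1 (hlam y k).le
      positivity
    refine ((continuous_const.sub ((hev _ hl).div (hd lam _ hl) fun y => (hlam y _).ne')).div
      (continuous_const.add (((hev _ hk).sub (hev _ hl)).div (hd gam _ hl)
        fun y => (hgam y _).ne')) fun y => hden y _ _).mul
      ((continuous_const.add (((hev _ hl).sub (hev _ hk)).div (hd gam _ hk)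
        fun y => (hgam y _).ne')).div (continuous_const.add ((hev _ hl).div (hd lam _ hk)
        fun y => (hlam y _).ne')) fun y => hden' y _ _)
  have : CompactSpace K := isCompact_iff_compactSpace.1 hK
  refine (isCompact_univ.continuous_sInf (f := φ) hφ).congr fun B => ?_
  have hB : 0 < (B : ℝ) := hlo.trans_le B.2.1
  rw [Set.domRestrict_apply, auxValue]
  congr 1
  ext v
  simp only [Set.image_univ, Set.mem_range, Set.mem_ofPred_eq]
  constructor
  · rintro ⟨x, rfl⟩
    refine ⟨fun l => B * x.1.1 l, fun l => mul_nonneg hB.le (x.2.1 l), ?_, x.1.2.1, x.1.2.2, rfl⟩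
    rw [← Finset.mul_sum]
    nlinarith [x.2.2]
  · rintro ⟨e, he, hs, l, k, rfl⟩
    refine ⟨⟨(fun l => e l / B, l, k), fun l => div_nonneg (he l) hB.le, ?_⟩, ?_⟩
    · rw [← Finset.sum_div]
      exact div_le_one_of_le₀ hs hB.le
    · have h : ∀ l, (B : ℝ) * (e l / B) = e l := fun l => by field_simp
      simp only [φ, h]

end AuxValue

/-! ### The deterministic guarantee and the choice of `Δ`. -/

section Guarantee

variable {X : Type*} [MeasurableSpace X] {p : ℕ}

/-- Sampling error is absorbed by enlarging both `e` and `g` by `κ`, hence the budget by `2κ`. -/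
theorem CoupledMasses.of_close_left {μ μ' ν : Measure (DataPt X p)} {E E' : EventRule X p}
    {f : Classifier X p} {B κ : ℝ} (h : CoupledMasses μ ν E E' f B) (hκ : 0 ≤ κ)
    (hj : ∀ l, |jointMass μ E E' f l - jointMass μ' E E' f l| ≤ κ)
    (hm : ∀ l, |missMass μ E E' f l - missMass μ' E E' f l| ≤ κ) :
    CoupledMasses μ' ν E E' f (B + 2 * κ) := by
  intro l k hlk
  obtain ⟨e, g, he, hg, heg, h1, h2, h3, h4⟩ := h l k hlk
  have j1 := abs_le.1 (hj l)
  have j2 := abs_le.1 (hj k)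
  have m1 := abs_le.1 (hm l)
  have m2 := abs_le.1 (hm k)
  exact ⟨e + κ, g + κ, by linarith, by linarith, by linarith, by linarith, by linarith,
    by linarith, by linarith⟩

theorem CoupledMasses.of_close_right {μ ν ν' : Measure (DataPt X p)} {E E' : EventRule X p}
    {f : Classifier X p} {B κ : ℝ} (h : CoupledMasses μ ν E E' f B) (hκ : 0 ≤ κ)
    (hj : ∀ l, |jointMass ν E E' f l - jointMass ν' E E' f l| ≤ κ)
    (hm : ∀ l, |missMass ν E E' f l - missMass ν' E E' f l| ≤ κ) :
    CoupledMasses μ ν' E E' f (B + 2 * κ) := by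
  intro l k hlk
  obtain ⟨e, g, he, hg, heg, h1, h2, h3, h4⟩ := h l k hlk
  have j1 := abs_le.1 (hj l)
  have j2 := abs_le.1 (hj k)
  have m1 := abs_le.1 (hm l)
  have m2 := abs_le.1 (hm k)
  exact ⟨e + κ, g + κ, by linarith, by linarith, by linarith, by linarith, by linarith,
    by linarith, by linarith⟩

/-- The guarantee of ErrTolerant+ for a measure `Dhat` that is close to `D` on the class. -/
theorem errTolPlus_guarantee {D Dhat : Measure (DataPt X p)} [IsProbabilityMeasure D]
    [IsFiniteMeasure Dhat] (hp : 0 < p) {F : Set (Classifier X p)} {E E' : EventRule X p}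
    (hF : ∀ f ∈ F, Measurable f) (hE : ∀ b, MeasurableSet (E b))
    (hE' : ∀ b, MeasurableSet (E' b)) {τ : ℝ} {fstar : Classifier X p} (hτ : 0 < τ) (hτ1 : τ ≤ 1)
    (hopt : IsFairOptimal D F E E' τ fstar) {lam gam : Fin p → ℝ} {lam0 : ℝ}
    (hlam : ∀ l, lam l = jointMass D E E' fstar l) (hgam : ∀ l, gam l = condMass D E' fstar l)
    (hlam0 : ∀ l, lam0 ≤ lam l) {η ε ν Δ : ℝ} (hη : 0 < η) (hηl : η < lam0 / 2) (hΔ : 0 < Δ)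
    (hΔm : Δ ≤ 1 / 4 * marginPlus ε ν τ η lam0 (auxValue lam gam (η + Δ)))
    (hmin : ∀ Q ⊆ F, Q.Nonempty → ∃ f ∈ Q, ∀ g ∈ Q, predErr Dhat f ≤ predErr Dhat g)
    (hfwd : ∀ f ∈ F, CoupledMasses D Dhat E E' f (η + 2 * (Δ ^ 2 / 8)))
    (hbwd : ∀ f ∈ F, CoupledMasses Dhat D E E' f (η + 2 * (Δ ^ 2 / 8)))
    (herr : ∀ f ∈ F, |predErr Dhat f - predErr D f| ≤ Δ ^ 2 / 8)
    (hjm : ∀ f ∈ F, ∀ l, |jointMass Dhat E E' f l - jointMass D E E' f l| ≤ η + Δ ^ 2 / 8) :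
    (∃ f, IsErrTolPlusOptimal Dhat F E E' lam gam τ η Δ f) ∧
      ∀ f, IsErrTolPlusOptimal Dhat F E E' lam gam τ η Δ f →
        predErr D f - predErr D fstar ≤ ε ∧ τ - ν ≤ fairness D E E' f := by
  obtain ⟨⟨hfF, hfair⟩, -⟩ := hopt
  have hu : 0 < lam0 - 2 * η := by linarith
  have hΔm' : 4 * Δ ≤ marginPlus ε ν τ η lam0 (auxValue lam gam (η + Δ)) := by linarith
  rw [marginPlus, le_min_iff, le_min_iff] at hΔm'
  obtain ⟨hΔε, hΔν, hΔu⟩ := hΔm'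
  have hl1 : lam0 ≤ 1 := (hlam0 ⟨0, hp⟩).trans (hlam ⟨0, hp⟩ ▸ measureReal_le_one)
  have hΔ4 : Δ ≤ 1 / 4 := by linarith
  -- Quadratic in `Δ`: the deviation is later divided by `lam0 - 2η ≥ 4Δ` and must remain of order
  -- `Δ`.
  set κ := Δ ^ 2 / 8 with hκ
  have hκ0 : 0 < κ := by positivity
  have hκΔ : κ ≤ Δ / 32 := by nlinarith
  have hEf := fun f hf => measurableSet_eventOf hE (hF f hf)
  have hEf' := fun f hf => measurableSet_eventOf hE' (hF f hf)
  have hgam' : ∀ l, gam l = jointMass D E E' fstar l + missMass D E E' fstar l := fun l => by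
    rw [hgam, condMass_eq D (hEf _ hfF)]
  have hlg : ∀ l, lam l ≤ gam l := fun l => by
    rw [hlam, hgam']; linarith [missMass_nonneg D E E' fstar l]
  have hBl : ∀ l, η + Δ < lam l := fun l => by linarith [hlam0 l]
  have hB0 : 0 ≤ η + Δ := by linarith
  set s := auxValue lam gam (η + Δ) with hs
  have hs0 : 0 ≤ s := auxValue_nonneg hBl hlg hB0
  have hs1 : s ≤ 1 := auxValue_le_one hp hBl hlg hB0
  have hfeas : IsErrTolPlusFeasible Dhat F E E' lam gam τ η Δ fstar := by
    refine ⟨hfF, ?_, fun l => ?_⟩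
    · refine le_fairness_of_coupledMasses hp (hEf _ hfF) (hEf' _ hfF) (hfwd _ hfF) hτ.le
        (fun l => ?_) (fun l => ?_) (fun l k hlk e g he hg heg => ?_) ?_ hfair
      · rw [← hlam]; linarith [hBl l]
      · have := abs_le.1 (hjm _ hfF l)
        rw [← hlam] at this
        linarith [hBl l]
      · rw [← hgam', ← hgam', ← hlam, ← hlam]
        exact mul_le_mul_of_nonneg_left (auxValue_le hBl hlg hB0 hlk he hg (by linarith)) hτ.le
      · exact mul_le_one₀ hτ1 hs0 hs1
    · have := abs_le.1 (hjm _ hfF l)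
      rw [← hlam] at this
      linarith
  refine ⟨?_, fun f hf => ?_⟩
  · obtain ⟨f, hf, hmf⟩ := hmin {f | IsErrTolPlusFeasible Dhat F E E' lam gam τ η Δ f}
      (fun f hf => hf.1) ⟨fstar, hfeas⟩
    exact ⟨f, hf, hmf⟩
  obtain ⟨⟨hf1, hf2, hf3⟩, hf4⟩ := hf
  refine ⟨?_, ?_⟩
  · have h1 := abs_le.1 (herr _ hf1)
    have h2 := abs_le.1 (herr _ hfF)
    linarith [hf4 _ hfeas]
  set B := η + 2 * κ with hB
  set m := lam0 - η - Δ with hm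
  have hBm : B < m := by linarith
  have hmf : ∀ l, m ≤ jointMass Dhat E E' f l := fun l => by linarith [hf3 l, hlam0 l]
  -- Bounding `m + B` below by `(lam0 - 2η)/2` is crude, but gives exactly the term `4η/(lam0 - 2η)`
  -- of the statement.
  have hfrac : 1 - (4 * η / (lam0 - 2 * η) + Δ) ≤ (m - B) / (m + B) := by
    have hmB : 0 < m + B := by linarith
    have h1 : (m - B) / (m + B) = 1 - 2 * B / (m + B) := by field_simp; ring
    have h2 : 2 * B / (m + B) ≤ 2 * B / ((lam0 - 2 * η) / 2) := by
      gcongr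
      linarith
    have h3 : 2 * B / ((lam0 - 2 * η) / 2) = 4 * η / (lam0 - 2 * η) + Δ ^ 2 / (lam0 - 2 * η) := by
      rw [hB, hκ]; field_simp; ring
    have h4 : Δ ^ 2 / (lam0 - 2 * η) ≤ Δ := by
      rw [div_le_iff₀ hu]; nlinarith
    linarith
  have hη' : 0 ≤ 4 * η / (lam0 - 2 * η) := by positivity
  have hτν : τ - ν ≤ τ * s - τ * (4 * η / (lam0 - 2 * η)) - 4 * Δ := by nlinarith
  have hτs : 0 ≤ τ * s := by positivity
  refine le_fairness_of_coupledMasses hp (hEf _ hf1) (hEf' _ hf1) (hbwd _ hf1) hτs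
    (fun l => hBm.trans_le (hmf l)) (fun l => ?_) (fun l k hlk e g he hg heg => ?_) ?_ hf2
  · have := abs_le.1 (hjm _ hf1 l)
    linarith [hmf l]
  · have h1 := le_ratio_factor he hg heg hBm (hmf l)
      (le_add_of_nonneg_right (missMass_nonneg Dhat E E' f l)) (hmf k)
      (le_add_of_nonneg_right (missMass_nonneg Dhat E E' f k))
    refine le_trans ?_ (mul_le_mul_of_nonneg_left (hfrac.trans h1) hτs)
    have h2 : τ * s * (4 * η / (lam0 - 2 * η) + Δ) ≤ τ * (4 * η / (lam0 - 2 * η) + Δ) := by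
      refine mul_le_mul_of_nonneg_right ?_ (by positivity)
      nlinarith
    nlinarith
  · have := mul_le_one₀ hτ1 hs0 hs1
    have := mul_nonneg hτ.le hη'
    linarith

/-- A relaxation parameter of the prescribed size exists. -/
theorem exists_relaxation {lam gam : Fin p → ℝ} {lam0 ε ν τ η c : ℝ}
    (hlam0 : ∀ l, lam0 ≤ lam l) (hlg : ∀ l, lam l ≤ gam l) (hc : 0 < c) (hc1 : c < 1)
    (hη : 0 < η) (hηl : η < lam0 / 2) (hε : 2 * η < ε)
    (hν : τ * (1 - auxValue lam gam η + 4 * η / (lam0 - 2 * η)) < ν) :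
    ∃ Δ : ℝ, 0 < Δ ∧
      τ * (1 - auxValue lam gam (η + Δ) + 4 * η / (lam0 - 2 * η)) < ν ∧
      Δ = c * marginPlus ε ν τ η lam0 (auxValue lam gam (η + Δ)) := by
  have hu : 0 < lam0 - 2 * η := by linarith
  have hcu : 0 < c * (lam0 - 2 * η) := by positivity
  have hcont : ContinuousOn (fun Δ => auxValue lam gam (η + Δ))
      (Set.Icc 0 (c * (lam0 - 2 * η))) := by
    refine (continuousOn_auxValue (hi := η + c * (lam0 - 2 * η)) hη (fun l => ?_) hlg).comp
      (by fun_prop) fun Δ hΔ => ⟨?_, ?_⟩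
    · nlinarith [hlam0 l]
    · linarith [hΔ.1]
    · linarith [hΔ.2]
  -- This function is positive at `0` and, as the margin is at most `lam0 - 2η`, nonpositive at the
  -- right end; its zero is the required `Δ`.
  have hcont' : ContinuousOn (fun Δ => c * marginPlus ε ν τ η lam0 (auxValue lam gam (η + Δ)) - Δ)
      (Set.Icc 0 (c * (lam0 - 2 * η))) := by
    unfold marginPlus
    fun_prop
  have h0 : 0 < c * marginPlus ε ν τ η lam0 (auxValue lam gam (η + 0)) - 0 := by
    rw [add_zero, sub_zero]
    exact mul_pos hc (lt_min (by linarith) (lt_min (by linarith) hu))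
  have h1 : c * marginPlus ε ν τ η lam0 (auxValue lam gam (η + c * (lam0 - 2 * η))) -
      c * (lam0 - 2 * η) ≤ 0 :=
    sub_nonpos.2 (mul_le_mul_of_nonneg_left ((min_le_right _ _).trans (min_le_right _ _)) hc.le)
  obtain ⟨Δ, hΔ, hΔ0⟩ := intermediate_value_Icc' hcu.le hcont' ⟨h1, h0.le⟩
  dsimp only at hΔ0
  have hpos : 0 < Δ := by
    refine hΔ.1.lt_of_ne fun h => ?_
    rw [← h] at hΔ0
    exact h0.ne' hΔ0
  refine ⟨Δ, hpos, ?_, by linarith⟩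
  have h2 : 0 < marginPlus ε ν τ η lam0 (auxValue lam gam (η + Δ)) :=
    pos_of_mul_pos_right (by linarith : 0 < c * marginPlus ε ν τ η lam0 _) hc.le
  rw [marginPlus, lt_min_iff, lt_min_iff] at h2
  linarith [h2.2.1]

end Guarantee

/-! ### Sample size. -/

/-- The sample size that makes the failure probability of all deviation bounds at most `δ`. -/
theorem failure_le_of_sample_size {p d N : ℕ} {Δ δ : ℝ} (hp : 0 < p) (hΔ : 0 < Δ) (hδ : 0 < δ)
    (hδ1 : δ < 1)
    (hN : 2 ^ 20 * (d : ℝ) ^ 2 * (1 / Δ) ^ 8 + 256 * (5 + Real.log (p / δ)) * (1 / Δ) ^ 4 ≤ N) :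
    0 < N ∧ (1 + (p + p) : ℕ) * (2 * ((2 * N + 1) ^ d *
      Real.exp (-(N * (Δ ^ 2 / 8) ^ 2 / 2)))) ≤ δ := by
  have hp1 : (1 : ℝ) ≤ p := by exact_mod_cast hp
  have hL : 0 ≤ Real.log (p / δ) := Real.log_nonneg ((one_le_div hδ).2 (by linarith))
  have hA : 0 ≤ 2 ^ 20 * (d : ℝ) ^ 2 * (1 / Δ) ^ 8 := by positivity
  have hC : 0 < 256 * (5 + Real.log (p / δ)) * (1 / Δ) ^ 4 := by positivity
  have hN0 : (0 : ℝ) < N := by linarith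
  have hN1 : (1 : ℝ) ≤ N := by exact_mod_cast Nat.cast_pos.1 hN0
  refine ⟨Nat.cast_pos.1 hN0, ?_⟩
  -- Half of the exponent pays for `p / δ` and the constant `6` of the union bound (`6 exp (-5) ≤
  -- 1`), the other half for the growth function.
  have h1 : 5 + Real.log (p / δ) ≤ N * (Δ ^ 2 / 8) ^ 2 / 4 := by
    have : 256 * (5 + Real.log (p / δ)) * (1 / Δ) ^ 4 ≤ N := by linarith
    rw [one_div, inv_pow, ← div_eq_mul_inv, div_le_iff₀ (by positivity)] at this
    nlinarith
  -- The bound `log (2N + 1) ≤ 4 √N` keeps the sample size polynomial: it suffices that `√N ≥ 1024 d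
  -- / Δ⁴`, whence the power `8`.
  have h2 : d * Real.log (2 * N + 1) ≤ N * (Δ ^ 2 / 8) ^ 2 / 4 := by
    set r := Real.sqrt N with hr
    have hr0 : 0 < r := Real.sqrt_pos.2 hN0
    have hrr : r ^ 2 = N := Real.sq_sqrt hN0.le
    have hlog : Real.log (2 * N + 1) ≤ 4 * r := by
      have h3 : (2 * N + 1 : ℝ) ≤ (2 * r) ^ 2 := by rw [mul_pow, hrr]; linarith
      have h4 := Real.log_le_log (by positivity) h3
      rw [Real.log_pow] at h4
      have h5 := Real.log_le_sub_one_of_pos (by positivity : 0 < 2 * r)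
      push_cast at h4
      linarith
    have h3 : 1024 * d ≤ r * Δ ^ 4 := by
      have : 2 ^ 20 * (d : ℝ) ^ 2 * (1 / Δ) ^ 8 ≤ N := by linarith
      rw [one_div, inv_pow, ← div_eq_mul_inv, div_le_iff₀ (by positivity), ← hrr] at this
      refine abs_le_of_sq_le_sq' (a := 1024 * (d : ℝ)) ?_ (by positivity) |>.2
      nlinarith
    calc d * Real.log (2 * N + 1) ≤ d * (4 * r) := by gcongr
      _ = 1024 * d * r / 256 := by ring
      _ ≤ r * Δ ^ 4 * r / 256 := by gcongr
      _ = r ^ 2 * (Δ ^ 2 / 8) ^ 2 / 4 := by ring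
      _ = _ := by rw [hrr]
  have hpow : ((2 * N + 1 : ℝ)) ^ d = Real.exp (d * Real.log (2 * N + 1)) := by
    rw [Real.exp_nat_mul, Real.exp_log (by positivity)]
  have hexp : (2 * N + 1 : ℝ) ^ d * Real.exp (-(N * (Δ ^ 2 / 8) ^ 2 / 2)) ≤
      Real.exp (-5) * (δ / p) := by
    rw [hpow, ← Real.exp_add]
    have h3 : δ / p = Real.exp (-Real.log (p / δ)) := by
      rw [Real.exp_neg, Real.exp_log (by positivity), inv_div]
    rw [h3, ← Real.exp_add]
    exact Real.exp_le_exp.2 (by linarith)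
  have h5 : 6 * Real.exp (-5) ≤ 1 := by
    have h := Real.add_one_le_exp (5 : ℝ)
    rw [Real.exp_neg, ← div_eq_mul_inv, div_le_one (Real.exp_pos _)]
    linarith
  calc ((1 + (p + p) : ℕ) : ℝ) * (2 * ((2 * N + 1) ^ d * Real.exp (-(N * (Δ ^ 2 / 8) ^ 2 / 2))))
      ≤ (3 * p) * (2 * (Real.exp (-5) * (δ / p))) := by
        gcongr
        push_cast
        linarith
    _ = 6 * Real.exp (-5) * δ := by field_simp; ring
    _ ≤ δ := by nlinarith

/-! ### From sampling and perturbation to the deterministic hypotheses. -/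

section Sampling

variable {X : Type*} [MeasurableSpace X] {p N : ℕ}

theorem isFiniteMeasure_empiricalDist {W : Type*} [MeasurableSpace W] (hN : 0 < N)
    (S : Fin N → W) : IsFiniteMeasure (empiricalDist S) := by
  have h : (N : ENNReal)⁻¹ ≠ ⊤ := by simpa using hN.ne'
  exact Measure.smul_finite _ h

/-- On an empirical distribution every class has a member of least error. -/
theorem exists_min_predErr_empiricalDist {F : Set (Classifier X p)} (hF : ∀ f ∈ F, Measurable f)
    (S : Fin N → DataPt X p) {Q : Set (Classifier X p)} (hQ : Q ⊆ F) (hne : Q.Nonempty) :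
    ∃ f ∈ Q, ∀ g ∈ Q, predErr (empiricalDist S) f ≤ predErr (empiricalDist S) g := by
  classical
  -- Errors are counts divided by `N`, so the minimum is attained by well-ordering of `ℕ`, even for
  -- an infinite class.
  let cnt : Classifier X p → ℕ := fun f =>
    (Finset.univ.filter fun i => f ((S i).1, (S i).2.2) ≠ (S i).2.1).card
  have herr : ∀ f ∈ F, predErr (empiricalDist S) f = cnt f / N := fun f hf => by
    have hm : MeasurableSet {w : DataPt X p | f (w.1, w.2.2) ≠ w.2.1} :=
      (measurableSet_eq_fun ((hF f hf).comp (by fun_prop)) (by fun_prop)).compl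
    rw [predErr, empiricalDist_real_apply S hm]
    simp only [cnt, Set.indicator_apply, Set.mem_ofPred_eq, Finset.sum_boole]
  refine ⟨Function.argminOn cnt Q hne, Function.argminOn_mem cnt Q hne, fun g hg => ?_⟩
  rw [herr _ (hQ (Function.argminOn_mem cnt Q hne)), herr _ (hQ hg)]
  have : cnt (Function.argminOn cnt Q hne) ≤ cnt g := Function.argminOn_le cnt Q hg
  gcongr

theorem coupledMasses_empiricalDist {E E' : EventRule X p} (hE : ∀ b, MeasurableSet (E b))
    (hE' : ∀ b, MeasurableSet (E' b)) {f : Classifier X p} (hf : Measurable f) (hN : 0 < N)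
    {η : ℝ} {S S' : Fin N → DataPt X p}
    (hS : ∀ i, (S i).2.2 = (S' i).2.2 → S i = S' i)
    (hc : ((Finset.univ.filter fun i => (S i).2.2 ≠ (S' i).2.2).card : ℝ) ≤ η * N) :
    CoupledMasses (empiricalDist S) (empiricalDist S') E E' f η := by
  intro l k hlk
  have hN' : (0 : ℝ) < N := Nat.cast_pos.2 hN
  obtain ⟨e, g, he, hg, heg, h1, h2⟩ := exists_coupled_moves hS hc hlk
  have hEm := measurableSet_eventOf hE hf
  have hEm' := measurableSet_eventOf hE' hf
  have hj : ∀ l, MeasurableSet (eventOf E f ∩ eventOf E' f ∩ groupEv X l) := fun l =>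
    (hEm.inter hEm').inter (measurableSet_groupEv l)
  have hm : ∀ l, MeasurableSet ((eventOf E' f \ eventOf E f) ∩ groupEv X l) := fun l =>
    (hEm'.diff hEm).inter (measurableSet_groupEv l)
  simp only [jointMass, missMass, empiricalDist_real_apply _ (hj _),
    empiricalDist_real_apply _ (hm _)]
  refine ⟨e / N, g / N, by positivity, by positivity, ?_, ?_, ?_, ?_, ?_⟩
  · rw [← add_div, div_le_iff₀ hN']; exact heg
  · rw [← sub_div]; gcongr; exact (h1 _ Set.inter_subset_right).1
  · rw [← add_div]; gcongr; exact (h1 _ Set.inter_subset_right).2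
  · rw [← add_div]; gcongr; exact (h2 _ Set.inter_subset_right).2
  · rw [← sub_div]; gcongr; exact (h2 _ Set.inter_subset_right).1

/-- The rules of the events whose frequencies have to be uniformly close to their probabilities:
errors, and for each group the points in `ℰ ∩ ℰ'` and in `ℰ' \ ℰ`. -/
def deviationRule (E E' : EventRule X p) : Unit ⊕ (Fin p ⊕ Fin p) → EventRule X p
  | .inl _ => fun b => {w | b ≠ w.2.1}
  | .inr (.inl l) => fun b => E b ∩ E' b ∩ groupEv X l
  | .inr (.inr l) => fun b => (E' b \ E b) ∩ groupEv X l

theorem measurableSet_deviationRule {E E' : EventRule X p} (hE : ∀ b, MeasurableSet (E b))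
    (hE' : ∀ b, MeasurableSet (E' b)) (j : Unit ⊕ (Fin p ⊕ Fin p)) (b : Bool) :
    MeasurableSet (deviationRule E E' j b) := by
  rcases j with _ | l | l
  · exact (measurableSet_eq_fun measurable_const (by fun_prop)).compl
  · exact ((hE b).inter (hE' b)).inter (measurableSet_groupEv l)
  · exact ((hE' b).diff (hE b)).inter (measurableSet_groupEv l)

/-- The samples on which some frequency deviates by more than `κ` from its probability. -/
def deviationEvent (D : Measure (DataPt X p)) (F : Set (Classifier X p)) (E E' : EventRule X p)
    (N : ℕ) (κ : ℝ) : Set (Fin N → DataPt X p) :=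
  ⋃ j, {S | ∃ f ∈ F, N * κ < |∑ i, ruleInd (fun w : DataPt X p => (w.1, w.2.2))
    (deviationRule E E' j) f (S i) -
      N * D.real (ruleSet (fun w : DataPt X p => (w.1, w.2.2)) (deviationRule E E' j) f)|}

theorem measure_deviationEvent_le (D : Measure (DataPt X p)) [IsProbabilityMeasure D]
    {F : Set (Classifier X p)} (hpm : IsPointwiseMeasurable F) {d : ℕ} (hvc : HasVCDim F d)
    {E E' : EventRule X p} (hE : ∀ b, MeasurableSet (E b)) (hE' : ∀ b, MeasurableSet (E' b))
    (N : ℕ) {κ : ℝ} (hκ : 0 < κ) :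
    (Measure.pi fun _ : Fin N => D) (deviationEvent D F E E' N κ) ≤
      ENNReal.ofReal ((1 + (p + p) : ℕ) *
        (2 * ((2 * N + 1) ^ d * Real.exp (-(N * κ ^ 2 / 2))))) := by
  refine (measure_iUnion_fintype_le _ _).trans ((Finset.sum_le_sum fun j _ =>
    measure_deviation_le D hpm hvc.2 (by fun_prop) (measurableSet_deviationRule hE hE' j) N
      hκ).trans_eq ?_)
  rw [Finset.sum_const, nsmul_eq_mul, ENNReal.ofReal_mul (Nat.cast_nonneg _),
    ENNReal.ofReal_natCast]
  simp

theorem abs_empiricalDist_sub_le_of_notMem (D : Measure (DataPt X p))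
    {F : Set (Classifier X p)} {E E' : EventRule X p} (hE : ∀ b, MeasurableSet (E b))
    (hE' : ∀ b, MeasurableSet (E' b)) (hN : 0 < N) {κ : ℝ} {S : Fin N → DataPt X p}
    (hS : S ∉ deviationEvent D F E E' N κ) {f : Classifier X p} (hf : f ∈ F)
    (hfm : Measurable f) (j : Unit ⊕ (Fin p ⊕ Fin p)) :
    |(empiricalDist S).real (ruleSet (fun w : DataPt X p => (w.1, w.2.2))
        (deviationRule E E' j) f) -
      D.real (ruleSet (fun w : DataPt X p => (w.1, w.2.2)) (deviationRule E E' j) f)| ≤ κ := by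
  have hN' : (0 : ℝ) < N := Nat.cast_pos.2 hN
  rw [empiricalDist_real_apply S (measurableSet_ruleSet (by fun_prop)
    (measurableSet_deviationRule hE hE' j) hfm)]
  have h : ∀ a b : ℝ, a / N - b = (a - N * b) / N := fun a b => by field_simp
  rw [h, abs_div, abs_of_pos hN', div_le_iff₀ hN', mul_comm κ]
  by_contra hlt
  exact hS (Set.mem_iUnion.2 ⟨j, f, hf, not_le.1 hlt⟩)

theorem predErr_perturbed {F : Set (Classifier X p)} (hF : IgnoresProtected F)
    {f : Classifier X p} (hf : f ∈ F) (hfm : Measurable f) (S : Fin N → DataPt X p)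
    (z : Fin N → Fin p) :
    predErr (empiricalDist (perturbed S z)) f = predErr (empiricalDist S) f := by
  have hm : MeasurableSet {w : DataPt X p | f (w.1, w.2.2) ≠ w.2.1} :=
    (measurableSet_eq_fun (hfm.comp (by fun_prop)) (by fun_prop)).compl
  classical
  rw [predErr, predErr, empiricalDist_real_apply _ hm, empiricalDist_real_apply _ hm]
  congr 1
  refine Finset.sum_congr rfl fun i _ => ?_
  simp only [perturbed, Set.indicator_apply, Set.mem_ofPred_eq, hF f hf _ (z i) (S i).2.2]

end Sampling

/-! ### The theorem. -/

theorem mainTheorem7 :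
    -- absolute constants: the constant of the `O(·)` for `Δ` and the polynomial for `N`
    ∃ c : ℝ, 0 < c ∧ ∃ P : MvPolynomial (Fin 3) ℝ,
      ∀ {X : Type*} [MeasurableSpace X] (p : ℕ)
        (D : Measure (DataPt X p)) [IsProbabilityMeasure D]
        (F : Set (Classifier X p)) (d : ℕ) (E E' : EventRule X p),
        IsPointwiseMeasurable F → HasVCDim F d → IgnoresProtected F →
        (∀ b, MeasurableSet (E b)) → (∀ b, MeasurableSet (E' b)) →
        ∀ (τ : ℝ) (fstar : Classifier X p),
          0 < τ → τ ≤ 1 → IsFairOptimal D F E E' τ fstar →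
        ∀ (lam gam : Fin p → ℝ) (lam0 : ℝ),
          (∀ l, lam l = jointMass D E E' fstar l) →
          (∀ l, gam l = condMass D E' fstar l) →
          lam0 = (⨅ l, lam l) →
        ∀ (η ε ν δ : ℝ), 0 < η → η < lam0 / 2 → 2 * η < ε → 0 < δ → δ < 1 →
          -- a relaxation parameter `Δ` of the prescribed size exists (`s` depends on `Δ`)
          (τ * (1 - auxValue lam gam η + 4 * η / (lam0 - 2 * η)) < ν →
            ∃ Δ : ℝ, 0 < Δ ∧
              τ * (1 - auxValue lam gam (η + Δ) + 4 * η / (lam0 - 2 * η)) < ν ∧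
              Δ = c * marginPlus ε ν τ η lam0 (auxValue lam gam (η + Δ))) ∧
          -- the guarantee
          ∀ Δ : ℝ, 0 < Δ →
            τ * (1 - auxValue lam gam (η + Δ) + 4 * η / (lam0 - 2 * η)) < ν →
            Δ ≤ c * marginPlus ε ν τ η lam0 (auxValue lam gam (η + Δ)) →
            ∀ N : ℕ, MvPolynomial.eval ![(d : ℝ), 1 / Δ, Real.log (p / δ)] P ≤ N →
            ∀ {R : Type*} [MeasurableSpace R] (ρ : Measure R) [IsProbabilityMeasure ρ]
              (A : (Fin N → DataPt X p) → R → Fin N → Fin p), IsHammingAdversary η A →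
              ((Measure.pi fun _ : Fin N => D).prod ρ)
                {ω | ¬ ((∃ f, IsErrTolPlusOptimal (empiricalDist (perturbed ω.1 (A ω.1 ω.2)))
                          F E E' lam gam τ η Δ f) ∧
                      ∀ f, IsErrTolPlusOptimal (empiricalDist (perturbed ω.1 (A ω.1 ω.2)))
                          F E E' lam gam τ η Δ f →
                        predErr D f - predErr D fstar ≤ ε ∧ τ - ν ≤ fairness D E E' f)}
                ≤ ENNReal.ofReal δ := by

  refine ⟨1 / 4, by norm_num, MvPolynomial.C (2 ^ 20) * MvPolynomial.X 0 ^ 2 * MvPolynomial.X 1 ^ 8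
    + MvPolynomial.C 256 * (MvPolynomial.C 5 + MvPolynomial.X 2) * MvPolynomial.X 1 ^ 4, ?_⟩
  intro X _ p D _ F d E E' hpm hvc hign hE hE' τ fstar hτ hτ1 hopt lam gam lam0 hlam hgam hlam0
    η ε ν δ hη hηl hε hδ hδ1
  have hp : 0 < p := by
    obtain ⟨w⟩ := nonempty_of_isProbabilityMeasure D
    exact w.2.2.pos
  have hFm := hpm.1
  have hlam0' : ∀ l, lam0 ≤ lam l := fun l =>
    hlam0 ▸ ciInf_le (Set.finite_range _).bddBelow l
  have hlg : ∀ l, lam l ≤ gam l := fun l => by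
    rw [hlam, hgam, condMass_eq D (measurableSet_eventOf hE (hFm _ hopt.1.1))]
    linarith [missMass_nonneg D E E' fstar l]
  refine ⟨exists_relaxation hlam0' hlg (by norm_num) (by norm_num) hη hηl hε,
    fun Δ hΔ _ hΔm N hN R _ ρ _ A hA => ?_⟩
  simp only [map_add, map_mul, map_pow, MvPolynomial.eval_C, MvPolynomial.eval_X,
    Matrix.cons_val_zero, Matrix.cons_val_one, Matrix.cons_val] at hN
  obtain ⟨hN0, hfail⟩ := failure_le_of_sample_size hp hΔ hδ hδ1 hN
  set κ := Δ ^ 2 / 8 with hκ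
  have hκ0 : 0 < κ := by positivity
  have hN' : (0 : ℝ) < N := Nat.cast_pos.2 hN0
  have hbound := (measure_deviationEvent_le D hpm hvc hE hE' N hκ0).trans
    (ENNReal.ofReal_le_ofReal hfail)
  -- The failure event need not be measurable, since the adversary is arbitrary. It lies in a
  -- rectangle that involves only the clean samples, and the product formula for rectangles holds
  -- for outer measure.
  refine le_trans (measure_mono (t := deviationEvent D F E E' N κ ×ˢ Set.univ) ?_)
    (by rw [Measure.prod_prod, measure_univ, mul_one]; exact hbound)
  rintro ⟨S, r⟩ hbad
  refine ⟨?_, Set.mem_univ _⟩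
  by_contra hS
  refine hbad ?_
  dsimp only
  set S' := perturbed S (A S r) with hS'
  have := isFiniteMeasure_empiricalDist hN0 S'
  have hdev := fun f (hf : f ∈ F) =>
    abs_empiricalDist_sub_le_of_notMem D hE hE' hN0 hS hf (hFm f hf)
  have hj : ∀ f ∈ F, ∀ l, |jointMass (empiricalDist S) E E' f l - jointMass D E E' f l| ≤ κ :=
    fun f hf l => hdev f hf (.inr (.inl l))
  have hm : ∀ f ∈ F, ∀ l, |missMass (empiricalDist S) E E' f l - missMass D E E' f l| ≤ κ :=
    fun f hf l => hdev f hf (.inr (.inr l))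
  have hsame : ∀ i, (S i).2.2 = (S' i).2.2 → S i = S' i := fun i h =>
    Prod.ext rfl (Prod.ext rfl h)
  have hcard' : ((Finset.univ.filter fun i => (S' i).2.2 ≠ (S i).2.2).card : ℝ) ≤ η * N := hA S r
  have hcard : ((Finset.univ.filter fun i => (S i).2.2 ≠ (S' i).2.2).card : ℝ) ≤ η * N := by
    simp_rw [ne_comm (a := (S _).2.2)]
    exact hcard'
  refine errTolPlus_guarantee hp hFm hE hE' hτ hτ1 hopt hlam hgam hlam0' hη hηl hΔ hΔm
    (fun Q hQ hne => exists_min_predErr_empiricalDist hFm S' hQ hne) (fun f hf => ?_)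
    (fun f hf => ?_) (fun f hf => ?_) fun f hf l => ?_
  · exact (coupledMasses_empiricalDist hE hE' (hFm f hf) hN0 hsame hcard).of_close_left hκ0.le
      (hj f hf) (hm f hf)
  · exact (coupledMasses_empiricalDist hE hE' (hFm f hf) hN0 (fun i h => (hsame i h.symm).symm)
      hcard').of_close_right hκ0.le (hj f hf) (hm f hf)
  · rw [predErr_perturbed hign hf (hFm f hf)]
    exact hdev f hf (.inl ())
  · have h1 : |jointMass (empiricalDist S') E E' f l - jointMass (empiricalDist S) E E' f l| ≤ η := by
      have hms : MeasurableSet (eventOf E f ∩ eventOf E' f ∩ groupEv X l) :=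
        ((measurableSet_eventOf hE (hFm f hf)).inter
          (measurableSet_eventOf hE' (hFm f hf))).inter (measurableSet_groupEv l)
      rw [jointMass, jointMass, empiricalDist_real_apply _ hms, empiricalDist_real_apply _ hms,
        ← sub_div, abs_div, abs_of_pos hN', div_le_iff₀ hN']
      exact abs_sum_indicator_sub_le hsame hcard _
    exact (abs_sub_le _ _ _).trans (add_le_add h1 (hj f hf l))
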